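/- For a finite set $V$ of qubits, a \emph{QAC circuit} of depth $d$ on $V$ is a product $L_dM_d\cdots L_1M_1L_0$, where each $L_k$ is a tensor product of arbitrary single-qubit unitaries and each $M_k$ is a layer of generalized $\mathrm{CZ}$ gates ($|x\rangle\mapsto-|x\rangle$ if all bits of $x$ on the support are $1$, and $|x\rangle\mapsto|x\rangle$ otherwise) with nonempty, pairwise disjoint supports. A \emph{$(w,\ell)$-2D-QAC circuit} is a QAC circuit whose qubits form a lattice with $w$ rows of length $\ell$ and in which the support of each $\mathrm{CZ}$ gate is a contiguous interval of qubits in one row or one column. A family $\{C_n\}_{n\in\mathbb N}$ of (2D-)QAC circuits is a \emph{(2D-)QAC$^0$ family} if its depth is bounded by a constant and its size (number of qubits) is bounded by a polynomial in $n$. Let $U_{\oplus_n}|x,b\rangle=|x,b\oplus x_1\oplus\cdots\oplus x_n\rangle$ for $x\in\{0,1\}^n$, $b\in\{0,1\}$. A circuit $C$ on $n+1+a$ qubits \emph{solves the $p$-approximate clean $U_{\oplus_n}$ problem} if for every $(n+1)$-qubit state $|\varphi\rangle$ the fidelity $|\langle\psi|\psi'\rangle|^2$ of $|\psi\rangle=C(|\varphi\rangle\otimes|0^a\rangle)$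 and $|\psi'\rangle=(U_{\oplus_n}|\varphi\rangle)\otimes|0^a\rangle$ is at least $p$. It \emph{exactly implements} $U_{\oplus_n}$ if $C(|\varphi\rangle\otimes|0^a\rangle)=(U_{\oplus_n}|\varphi\rangle)\otimes|0^a\rangle$ for every $|\varphi\rangle$. In a 2D-QAC circuit the $n+1$ input and target qubits may sit at any fixed distinct lattice sites, and all the other sites are ancillas. \textbf{Theorem.} Let $p>\tfrac12$ be a constant and suppose that there is a QAC$^0$ family $\{C_n\}_{n\in\mathbb N}$ such that, for every $n$, $C_n$ solves the $p$-approximate clean $U_{\oplus_n}$ problem. Then for every constant $\varepsilon>0$ there is a 2D-QAC$^0$ family $\{D_n\}_{n\in\mathbb N}$ (whose depth bound may depend on $\varepsilon$) such that $D_n$ exactly implements $U_{\oplus_n}$ for every $n$, and for all sufficiently large $n$ the circuit $D_n$ lives on a lattice with $\lfloor n^{\varepsilon}\rfloor$ rows of length $\lfloor n^{1+\varepsilon}\rfloor$. -/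

import Mathlib

/-! ### Qubit registers

A register of qubits is indexed by a finite type `V`; its computational basis is `V → Bool`
(`true` is the bit `1`), and its state vectors are the functions `(V → Bool) → ℂ`. -/

/-- `ψ` is a (normalized) pure state of the register `V`. -/
def IsPureState {V : Type} [Fintype V] [DecidableEq V] (ψ : (V → Bool) → ℂ) : Prop :=
  ∑ x, ‖ψ x‖ ^ 2 = 1

/-- The fidelity `|⟨ψ|φ⟩|²` of two pure states. -/
noncomputable def pureFidelity {V : Type} [Fintype V] [DecidableEq V]
    (ψ φ : (V → Bool) → ℂ) : ℝ :=
  ‖star ψ ⬝ᵥ φ‖ ^ 2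

/-- The state `|φ⟩ ⊗ |0…0⟩` of the register `V`: the state `φ` is placed on the qubits
`ι i`, `i : W`, and all the other qubits (the ancillas) are in the state `|0⟩`. -/
noncomputable def withAncilla {V W : Type} [Fintype V] [DecidableEq V] [Fintype W]
    [DecidableEq W] (ι : W ↪ V) (φ : (W → Bool) → ℂ) : (V → Bool) → ℂ :=
  fun x => open Classical in
    if ∀ v, v ∉ Set.range ι → x v = false then φ (fun i => x (ι i)) else 0

/-! ### QAC circuits -/

/-- A layer of (generalized) `CZ` gates, given by their supports: nonempty, pairwise disjoint
sets of qubits. -/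
structure CZLayer (V : Type) [DecidableEq V] where
  supports : Finset (Finset V)
  nonempty : ∀ S ∈ supports, S.Nonempty
  disjoint : (supports : Set (Finset V)).PairwiseDisjoint id

/-- The unitary of a layer of `CZ` gates: a basis state `|x⟩` picks up a factor `-1` for every
gate on whose support `x` is constantly `1`. -/
noncomputable def CZLayer.toMatrix {V : Type} [Fintype V] [DecidableEq V] (M : CZLayer V) :
    Matrix (V → Bool) (V → Bool) ℂ :=
  Matrix.diagonal fun x => ∏ S ∈ M.supports, if ∀ v ∈ S, x v = true then (-1 : ℂ) else 1

/-- The tensor product of one single-qubit unitary for every qubit. -/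
noncomputable def singleQubitLayer {V : Type} [Fintype V] [DecidableEq V]
    (L : V → Matrix.unitaryGroup Bool ℂ) : Matrix (V → Bool) (V → Bool) ℂ :=
  Matrix.of fun x y => ∏ v, (L v : Matrix Bool Bool ℂ) (x v) (y v)

/-- A QAC circuit `L_d M_d ⋯ L_1 M_1 L_0` on the qubits `V`: `init` is the layer `L_0` of
single-qubit unitaries, and `rounds` lists the pairs `(M_1, L_1), …, (M_d, L_d)` of a layer of
`CZ` gates followed by a layer of single-qubit unitaries. -/
structure QACCircuit (V : Type) [DecidableEq V] where
  init : V → Matrix.unitaryGroup Bool ℂ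
  rounds : List (CZLayer V × (V → Matrix.unitaryGroup Bool ℂ))

/-- The depth of a QAC circuit: the number of `CZ` layers. -/
def QACCircuit.depth {V : Type} [DecidableEq V] (C : QACCircuit V) : ℕ := C.rounds.length

/-- The unitary computed by a QAC circuit. -/
noncomputable def QACCircuit.toMatrix {V : Type} [Fintype V] [DecidableEq V]
    (C : QACCircuit V) : Matrix (V → Bool) (V → Bool) ℂ :=
  C.rounds.foldl (fun A r => singleQubitLayer r.2 * (r.1.toMatrix * A))
    (singleQubitLayer C.init)

/-- `C` solves the `p`-approximate clean `U` problem, the register of `U` being placed on the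
qubits of `C` by `ι`: for every input state `φ`, the fidelity of `C |φ, 0…0⟩` and
`(U |φ⟩) ⊗ |0…0⟩` is at least `p`. -/
def SolvesApproxClean {V W : Type} [Fintype V] [DecidableEq V] [Fintype W] [DecidableEq W]
    (p : ℝ) (C : QACCircuit V) (ι : W ↪ V) (U : Matrix (W → Bool) (W → Bool) ℂ) : Prop :=
  ∀ φ : (W → Bool) → ℂ, IsPureState φ →
    p ≤ pureFidelity (C.toMatrix.mulVec (withAncilla ι φ)) (withAncilla ι (U.mulVec φ))

/-- `C` exactly implements `U`, the register of `U` being placed on the qubits of `C` by `ι`: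
`C |φ, 0…0⟩ = (U |φ⟩) ⊗ |0…0⟩` for every input state `φ`. -/
def ExactlyImplements {V W : Type} [Fintype V] [DecidableEq V] [Fintype W] [DecidableEq W]
    (C : QACCircuit V) (ι : W ↪ V) (U : Matrix (W → Bool) (W → Bool) ℂ) : Prop :=
  ∀ φ : (W → Bool) → ℂ, IsPureState φ →
    C.toMatrix.mulVec (withAncilla ι φ) = withAncilla ι (U.mulVec φ)

/-! ### The parity unitary -/

/-- The parity `x_1 ⊕ ⋯ ⊕ x_n`. -/
def parityBit {n : ℕ} (x : Fin n → Bool) : Bool :=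
  decide (Odd (Finset.univ.filter fun i => x i = true).card)

/-- The unitary `|x, b⟩ ↦ |x, b ⊕ x_1 ⊕ ⋯ ⊕ x_n⟩` on `n + 1` qubits: `Sum.inl i` is the `i`-th
input qubit and `Sum.inr ()` is the target qubit. -/
def parityUnitary (n : ℕ) : Matrix (Fin n ⊕ Unit → Bool) (Fin n ⊕ Unit → Bool) ℂ :=
  Matrix.of fun y z =>
    if y = Sum.elim (fun i => z (Sum.inl i))
        (fun _ => xor (z (Sum.inr ())) (parityBit fun i => z (Sum.inl i)))
    then 1 else 0

/-! ### Circuit families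

The `n`-th circuit acts on the `n + 1` qubits of the parity unitary and on ancillas. The supports
in a layer are nonempty and disjoint, so in constant depth the number of gates is polynomial as
soon as the number of qubits is. -/

/-- A QAC⁰ family: constant depth and polynomial size. -/
structure QAC0Family where
  ancillas : ℕ → ℕ
  circuit : (n : ℕ) → QACCircuit ((Fin n ⊕ Unit) ⊕ Fin (ancillas n))
  const_depth : ∃ d : ℕ, ∀ n, (circuit n).depth ≤ d
  poly_size : ∃ c : ℕ, ∀ n, ancillas n ≤ n ^ c + c

/-- A contiguous interval of qubits in one row or in one column of a `w × l` lattice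
(`w` rows of length `l`). -/
def IsLineInterval {w l : ℕ} (S : Finset (Fin w × Fin l)) : Prop :=
  (∃ (i : Fin w) (a b : Fin l), S = {i} ×ˢ Finset.Icc a b) ∨
  (∃ (a b : Fin w) (j : Fin l), S = Finset.Icc a b ×ˢ {j})

/-- A QAC circuit on a `w × l` lattice is a 2D-QAC circuit if each of its `CZ` gates acts on a
contiguous interval of qubits in one row or in one column. -/
def QACCircuit.IsTwoDim {w l : ℕ} (C : QACCircuit (Fin w × Fin l)) : Prop :=
  ∀ r ∈ C.rounds, ∀ S ∈ r.1.supports, IsLineInterval S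

/-- A 2D-QAC⁰ family: 2D-QAC circuits of constant depth and polynomial size. The `n`-th circuit
lives on `rows n` rows of length `cols n`; `position n` says at which (distinct) lattice sites the
`n` input qubits and the target qubit are. All the other sites are ancillas. -/
structure TwoDimQAC0Family where
  rows : ℕ → ℕ
  cols : ℕ → ℕ
  circuit : (n : ℕ) → QACCircuit (Fin (rows n) × Fin (cols n))
  position : (n : ℕ) → (Fin n ⊕ Unit) ↪ (Fin (rows n) × Fin (cols n))
  two_dim : ∀ n, (circuit n).IsTwoDim
  const_depth : ∃ d : ℕ, ∀ n, (circuit n).depth ≤ d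
  poly_size : ∃ c : ℕ, ∀ n, rows n * cols n ≤ n ^ c + c

/-! Three ideas combine.

Exactness. Feed uniform input bits and target 0 to an approximate parity circuit, then apply
Hadamard gates to inputs and target. For exact parity the result is a cat state. In the approximate
case the amplitudes at `|0…0⟩` and at `|1…1⟩|0…0⟩` have absolute values summing to at least √(2p).
Each is at most 1, so both are at least √(2p) - 1 > 0 (`exists_cat_amplitudes`). Two extra qubits
equalize these amplitudes and tune them to a value for which j Grover iterations succeed with
certainty (`exists_superposition`, `exists_amplified`). Since j depends only on p, the depth stays
constant. A unitary preparing α(|0⟩ + |g⟩), with g equal to 1 at n chosen places, gives exact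
parity: CZ gates between these places and the inputs put the parity into the relative sign, and
unpreparing tests that sign (`exists_parity_of_superposition`).

Geometry. A circuit on N qubits runs on an N × (N+1) lattice with the data in the first column and
three CZ layers for each original one: copy the bits along rows, apply every gate in a column of its
own, uncopy (`exists_lattice_simulation`).

Dimensions. N is polynomial in the number m of inputs, so one such lattice is too tall. Instead the
circuits for m inputs form an m-ary tree with k+1 levels, where m is about n^(1/(k+1)). The subtrees
stand side by side and the combining circuit occupies N new rows below them, so heights add while
lengths grow by a factor of about m (`LatticeParity.compose`, `exists_latticeParity_pow`). If N =
O(m^c), the height is O(n^(c/(k+1))) and the length O(n^(1+c/(k+1))). A constant k > c/ε fits both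
within the required bounds (`eventually_exists_branching`). -/

/-- The computational basis state `|x⟩`. -/
noncomputable def ket {V : Type} [Fintype V] [DecidableEq V] (x : V → Bool) :
    (V → Bool) → ℂ :=
  Pi.single x 1

/-! ### Basis states and the algebra of single layers -/

section Layers

variable {V : Type} [Fintype V] [DecidableEq V]

theorem ket_apply (x y : V → Bool) : ket x y = if y = x then 1 else 0 := by
  simp [ket, Pi.single_apply]

theorem mulVec_ket (A : Matrix (V → Bool) (V → Bool) ℂ) (x y : V → Bool) :
    A.mulVec (ket x) y = A y x := by
  simp [ket]

theorem matrix_ext_ket {W : Type} {A B : Matrix W (V → Bool) ℂ}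
    (h : ∀ x, A.mulVec (ket x) = B.mulVec (ket x)) : A = B := by
  ext y x
  have := congrFun (h x) y
  simpa [ket] using this

theorem singleQubitLayer_mul (L L' : V → Matrix.unitaryGroup Bool ℂ) :
    singleQubitLayer (fun v => L v * L' v) = singleQubitLayer L * singleQubitLayer L' := by
  ext x z
  simp only [singleQubitLayer, Matrix.of_apply, Matrix.mul_apply, Submonoid.coe_mul,
    ← Finset.prod_mul_distrib]
  rw [Finset.prod_univ_sum]
  simp only [Fintype.piFinset_univ]

theorem singleQubitLayer_one :
    singleQubitLayer (fun _ : V => (1 : Matrix.unitaryGroup Bool ℂ)) = 1 := by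
  ext x y
  simp only [singleQubitLayer, Matrix.of_apply, OneMemClass.coe_one, Matrix.one_apply,
    Finset.prod_ite_zero, Finset.prod_const_one, funext_iff, Finset.mem_univ, true_imp_iff]

theorem singleQubitLayer_conjTranspose (L : V → Matrix.unitaryGroup Bool ℂ) :
    (singleQubitLayer L).conjTranspose = singleQubitLayer (fun v => (L v)⁻¹) := by
  ext x y
  simp [singleQubitLayer, Matrix.conjTranspose_apply, Matrix.star_apply]

theorem singleQubitLayer_mulVec_ket (L : V → Matrix.unitaryGroup Bool ℂ) (x y : V → Bool) :
    (singleQubitLayer L).mulVec (ket x) y = ∏ v, (L v : Matrix Bool Bool ℂ) (y v) (x v) := by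
  rw [mulVec_ket]; rfl

/-- The sign picked up by the basis state `|x⟩` in a layer of `CZ` gates. -/
noncomputable def CZLayer.sign (M : CZLayer V) (x : V → Bool) : ℂ :=
  ∏ S ∈ M.supports, if ∀ v ∈ S, x v = true then (-1 : ℂ) else 1

theorem CZLayer.sign_mul_self (M : CZLayer V) (x : V → Bool) : M.sign x * M.sign x = 1 := by
  rw [CZLayer.sign, ← Finset.prod_mul_distrib]
  exact Finset.prod_eq_one fun S _ => by split_ifs <;> norm_num

theorem CZLayer.star_sign (M : CZLayer V) (x : V → Bool) : star (M.sign x) = M.sign x := by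
  rw [CZLayer.sign, star_prod]
  exact Finset.prod_congr rfl fun S _ => by split_ifs <;> simp

theorem CZLayer.toMatrix_eq (M : CZLayer V) : M.toMatrix = Matrix.diagonal M.sign := rfl

theorem CZLayer.conjTranspose_toMatrix (M : CZLayer V) :
    M.toMatrix.conjTranspose = M.toMatrix := by
  rw [CZLayer.toMatrix_eq, Matrix.diagonal_conjTranspose]
  congr 1
  ext x
  exact M.star_sign x

theorem CZLayer.toMatrix_mul_self (M : CZLayer V) : M.toMatrix * M.toMatrix = 1 := by
  rw [CZLayer.toMatrix_eq, Matrix.diagonal_mul_diagonal]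
  simp [CZLayer.sign_mul_self]

theorem diagonal_mulVec_ket (f : (V → Bool) → ℂ) (x : V → Bool) :
    (Matrix.diagonal f).mulVec (ket x) = f x • ket x := by
  ext y
  rw [mulVec_ket]
  by_cases h : y = x <;> simp [ket_apply, h]

end Layers

/-! ### Realizable unitaries -/

/-- `A` is computed by a circuit with `d` layers of `CZ` gates, all of whose supports
satisfy `P`. -/
inductive Realizes {V : Type} [Fintype V] [DecidableEq V] (P : Finset V → Prop) :
    ℕ → Matrix (V → Bool) (V → Bool) ℂ → Prop
  | single (L : V → Matrix.unitaryGroup Bool ℂ) : Realizes P 0 (singleQubitLayer L)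
  | cz (M : CZLayer V) (h : ∀ S ∈ M.supports, P S) : Realizes P 1 M.toMatrix
  | mul {d₁ d₂ : ℕ} {A B : Matrix (V → Bool) (V → Bool) ℂ} (hA : Realizes P d₁ A)
      (hB : Realizes P d₂ B) : Realizes P (d₁ + d₂) (A * B)

namespace Realizes

variable {V : Type} [Fintype V] [DecidableEq V] {P : Finset V → Prop}

theorem one : Realizes P 0 1 := by
  rw [← singleQubitLayer_one]
  exact .single _

theorem mono {d d' : ℕ} {A : Matrix (V → Bool) (V → Bool) ℂ} (h : Realizes P d A)
    (hd : d ≤ d') : Realizes P d' A := by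
  induction d', hd using Nat.le_induction with
  | base => exact h
  | succ k _ ih =>
    -- An empty layer of CZ gates is the identity, so it pads the depth by one.
    have h1 : Realizes P 1 1 := by
      have := Realizes.cz (P := P) (V := V) ⟨∅, by simp, by simp⟩ (by simp)
      have e : CZLayer.toMatrix (V := V) ⟨∅, by simp, by simp⟩ = 1 := by
        simp [CZLayer.toMatrix]
      rwa [e] at this
    simpa using ih.mul h1

theorem conjTranspose {d : ℕ} {A : Matrix (V → Bool) (V → Bool) ℂ} (h : Realizes P d A) :
    Realizes P d A.conjTranspose := by
  induction h with
  | single L => rw [singleQubitLayer_conjTranspose]; exact .single _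
  | cz M h => rw [M.conjTranspose_toMatrix]; exact .cz M h
  | mul _ _ h₁ h₂ => rw [Matrix.conjTranspose_mul, add_comm]; exact h₂.mul h₁

theorem conjTranspose_mul_self {d : ℕ} {A : Matrix (V → Bool) (V → Bool) ℂ}
    (h : Realizes P d A) : A.conjTranspose * A = 1 := by
  induction h with
  | single L =>
    rw [singleQubitLayer_conjTranspose, ← singleQubitLayer_mul]
    simp [singleQubitLayer_one]
  | cz M h => rw [M.conjTranspose_toMatrix, M.toMatrix_mul_self]
  | @mul _ _ A B _ _ h₁ h₂ =>
    rw [Matrix.conjTranspose_mul, Matrix.mul_assoc, ← Matrix.mul_assoc _ A B, h₁,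
      Matrix.one_mul, h₂]

theorem mulVec_conjTranspose_mulVec {d : ℕ} {A : Matrix (V → Bool) (V → Bool) ℂ}
    (h : Realizes P d A) (φ : (V → Bool) → ℂ) : A.conjTranspose.mulVec (A.mulVec φ) = φ := by
  rw [Matrix.mulVec_mulVec, h.conjTranspose_mul_self, Matrix.one_mulVec]

theorem dotProduct_mulVec {d : ℕ} {A : Matrix (V → Bool) (V → Bool) ℂ}
    (h : Realizes P d A) (φ χ : (V → Bool) → ℂ) :
    star (A.mulVec φ) ⬝ᵥ A.mulVec χ = star φ ⬝ᵥ χ := by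
  rw [Matrix.star_mulVec, ← Matrix.dotProduct_mulVec, h.mulVec_conjTranspose_mulVec]

/-- The arbitrary circuit on the right makes the induction work: a layer of single-qubit gates is
absorbed into the last single-qubit layer already present, and hence costs no depth. -/
theorem exists_circuit_mul {d : ℕ} {A : Matrix (V → Bool) (V → Bool) ℂ} (h : Realizes P d A) :
    ∀ C : QACCircuit V, (∀ r ∈ C.rounds, ∀ S ∈ r.1.supports, P S) →
      ∃ C' : QACCircuit V, (∀ r ∈ C'.rounds, ∀ S ∈ r.1.supports, P S) ∧
        C'.depth = d + C.depth ∧ C'.toMatrix = A * C.toMatrix := by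
  induction h with
  | single L =>
    rintro ⟨L₀, rs⟩ hC
    induction rs using List.reverseRecOn with
    | nil =>
      refine ⟨⟨fun v => L v * L₀ v, []⟩, by simp, by simp [QACCircuit.depth], ?_⟩
      simp [QACCircuit.toMatrix, singleQubitLayer_mul]
    | append_singleton rs r _ =>
      refine ⟨⟨L₀, rs ++ [(r.1, fun v => L v * r.2 v)]⟩, ?_, by simp [QACCircuit.depth], ?_⟩
      · intro r' hr'
        simp only [List.mem_append, List.mem_singleton] at hr'
        rcases hr' with hr' | rfl
        · exact hC r' (by simp [hr'])
        · exact hC r (by simp)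
      · simp [QACCircuit.toMatrix, singleQubitLayer_mul, List.foldl_append, Matrix.mul_assoc]
  | cz M h =>
    rintro ⟨L₀, rs⟩ hC
    refine ⟨⟨L₀, rs ++ [(M, fun _ => 1)]⟩, ?_, by simp [QACCircuit.depth, add_comm], ?_⟩
    · intro r' hr'
      simp only [List.mem_append, List.mem_singleton] at hr'
      rcases hr' with hr' | rfl
      · exact hC r' hr'
      · exact h
    · simp [QACCircuit.toMatrix, singleQubitLayer_one, List.foldl_append]
  | mul _ _ h₁ h₂ =>
    intro C hC
    obtain ⟨C₂, hP₂, hd₂, hm₂⟩ := h₂ C hC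
    obtain ⟨C₁, hP₁, hd₁, hm₁⟩ := h₁ C₂ hP₂
    exact ⟨C₁, hP₁, by omega, by rw [hm₁, hm₂, Matrix.mul_assoc]⟩

theorem exists_circuit {d : ℕ} {A : Matrix (V → Bool) (V → Bool) ℂ} (h : Realizes P d A) :
    ∃ C : QACCircuit V, (∀ r ∈ C.rounds, ∀ S ∈ r.1.supports, P S) ∧
      C.depth = d ∧ C.toMatrix = A := by
  obtain ⟨C, hP, hd, hm⟩ := h.exists_circuit_mul ⟨fun _ => 1, []⟩ (by simp)
  refine ⟨C, hP, by simpa [QACCircuit.depth] using hd, ?_⟩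
  rw [hm]
  simp [QACCircuit.toMatrix, singleQubitLayer_one]

end Realizes

theorem QACCircuit.realizes {V : Type} [Fintype V] [DecidableEq V] (C : QACCircuit V) :
    Realizes (fun _ => True) C.depth C.toMatrix := by
  obtain ⟨L₀, rs⟩ := C
  induction rs using List.reverseRecOn with
  | nil => exact .single L₀
  | append_singleton rs r ih =>
    have := (Realizes.single (P := fun _ => True) r.2).mul ((Realizes.cz r.1 (by simp)).mul ih)
    simpa [QACCircuit.toMatrix, QACCircuit.depth, List.foldl_append, add_comm] using this

/-! ### Parallel copies of a unitary -/

section Parallel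

variable {I V V' : Type} [Fintype I] [Fintype V] [DecidableEq V] [Fintype V']
  [DecidableEq V']

/-- The unitary that acts as `A` on each of the disjoint registers `e (i, ·)` and as the identity
on the other qubits. -/
noncomputable def parallel (e : I × V ↪ V') (A : Matrix (V → Bool) (V → Bool) ℂ) :
    Matrix (V' → Bool) (V' → Bool) ℂ :=
  Matrix.of fun x y => open Classical in
    (∏ i, A (fun v => x (e (i, v))) (fun v => y (e (i, v)))) *
      if ∀ v, v ∉ Set.range e → x v = y v then 1 else 0

theorem parallel_mul (e : I × V ↪ V') (A B : Matrix (V → Bool) (V → Bool) ℂ) :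
    parallel e (A * B) = parallel e A * parallel e B := by
  classical
  ext x z
  simp only [parallel, Matrix.of_apply, Matrix.mul_apply]
  rw [Finset.prod_univ_sum, Finset.sum_mul]
  have hz : ∀ y : V' → Bool, ¬ (∀ v, v ∉ Set.range e → x v = y v) →
      ((∏ i, A (fun v => x (e (i, v))) (fun v => y (e (i, v)))) *
        if ∀ v, v ∉ Set.range e → x v = y v then (1 : ℂ) else 0) *
      ((∏ i, B (fun v => y (e (i, v))) (fun v => z (e (i, v)))) *
        if ∀ v, v ∉ Set.range e → y v = z v then 1 else 0) = 0 := by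
    intro y hy
    rw [if_neg hy, mul_zero, zero_mul]
  -- Only intermediate states agreeing with `x` outside the registers contribute. They correspond to
  -- families of register states, which is the index set after expanding the product of sums.
  rw [← Finset.sum_filter_of_ne (p := fun y : V' → Bool => ∀ v, v ∉ Set.range e → x v = y v)
    fun y _ hy => by_contra fun hc => hy (hz y hc)]
  refine Finset.sum_bij' (fun q _ => Function.extend e (fun p => q p.1 p.2) x)
    (fun y _ i v => y (e (i, v))) ?_ ?_ ?_ ?_ ?_
  · intro q _
    simp only [Finset.mem_filter, Finset.mem_univ, true_and]
    intro v hv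
    rw [Function.extend_apply' _ _ _ (by simpa using hv)]
  · simp
  · intro q _
    ext i v
    rw [e.injective.extend_apply]
  · intro y hy
    simp only [Finset.mem_filter, Finset.mem_univ, true_and] at hy
    ext v
    by_cases hv : v ∈ Set.range e
    · obtain ⟨p, rfl⟩ := hv
      rw [e.injective.extend_apply]
    · rw [Function.extend_apply' _ _ _ (by simpa using hv), hy v hv]
  · intro q _
    have h1 : ∀ v, v ∉ Set.range e → Function.extend e (fun p => q p.1 p.2) x v = x v :=
      fun v hv => Function.extend_apply' _ _ _ (by simpa using hv)
    simp only [e.injective.extend_apply]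
    have h2 : (∀ v, v ∉ Set.range e → x v = Function.extend e (fun p => q p.1 p.2) x v) :=
      fun v hv => (h1 v hv).symm
    have h3 : (∀ v, v ∉ Set.range e → Function.extend e (fun p => q p.1 p.2) x v = z v) ↔
        ∀ v, v ∉ Set.range e → x v = z v :=
      forall₂_congr fun v hv => by rw [h1 v hv]
    rw [if_pos h2, Finset.prod_mul_distrib, if_congr h3 rfl rfl]
    ring

theorem parallel_singleQubitLayer (e : I × V ↪ V') (L : V → Matrix.unitaryGroup Bool ℂ) :
    parallel e (singleQubitLayer L) =
      singleQubitLayer (Function.extend e (fun p => L p.2) fun _ => 1) := by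
  classical
  ext x y
  simp only [parallel, singleQubitLayer, Matrix.of_apply]
  rw [← Finset.prod_mul_prod_compl (Finset.univ.map e), Finset.prod_map,
    ← Finset.univ_product_univ, Finset.prod_product]
  congr 1
  · simp [e.injective.extend_apply]
  · rw [Finset.prod_congr rfl (g := fun v => if x v = y v then (1 : ℂ) else 0)]
    · rw [Finset.prod_ite_zero]
      simp
    · intro v hv
      rw [Function.extend_apply' _ _ _ (by simpa using hv)]
      simp [Matrix.one_apply]

/-- The layer made of copies of the layer `M` in each of the registers `e (i, ·)`. -/
def CZLayer.parallel (e : I × V ↪ V') (M : CZLayer V) : CZLayer V' where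
  supports := (Finset.univ ×ˢ M.supports).image fun q =>
    q.2.map ((Function.Embedding.sectR q.1 V).trans e)
  nonempty := by
    intro S hS
    simp only [Finset.mem_image, Finset.mem_product, Finset.mem_univ, true_and] at hS
    obtain ⟨q, hq, rfl⟩ := hS
    simpa using M.nonempty _ hq
  disjoint := by
    intro S hS T hT hST
    simp only [Finset.coe_image, Set.mem_image, Finset.mem_coe, Finset.mem_product,
      Finset.mem_univ, true_and] at hS hT
    obtain ⟨⟨i, S⟩, hS, rfl⟩ := hS
    obtain ⟨⟨j, T⟩, hT, rfl⟩ := hT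
    simp only [Function.onFun, id, Finset.disjoint_left, Finset.mem_map]
    rintro _ ⟨a, ha, rfl⟩ ⟨b, hb, hab⟩
    have hab' := e.injective hab
    simp only [Function.Embedding.sectR_apply, Prod.mk.injEq] at hab'
    obtain ⟨rfl, rfl⟩ := hab'
    by_cases h : S = T
    · subst h; exact hST rfl
    · exact Finset.disjoint_left.1 (M.disjoint hS hT h) ha hb

theorem CZLayer.sign_parallel (e : I × V ↪ V') (M : CZLayer V) (x : V' → Bool) :
    (M.parallel e).sign x = ∏ i, M.sign fun v => x (e (i, v)) := by
  simp only [CZLayer.sign, CZLayer.parallel]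
  rw [Finset.prod_image]
  · rw [Finset.prod_product]
    simp
  · rintro ⟨i, S⟩ hS ⟨j, T⟩ hT h
    simp only [Finset.coe_product, Set.mem_prod, Finset.mem_coe] at hS hT h
    -- Copies of an empty support in different registers would coincide; a point of the support
    -- identifies the register.
    obtain ⟨a, ha⟩ := M.nonempty _ hS.2
    have ha' : e (i, a) ∈ T.map ((Function.Embedding.sectR j V).trans e) := by
      rw [← h]; simp [ha]
    simp only [Finset.mem_map, Function.Embedding.trans_apply,
      Function.Embedding.sectR_apply] at ha'
    obtain ⟨b, hb, hab⟩ := ha'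
    have := e.injective hab
    simp only [Prod.mk.injEq] at this
    obtain ⟨rfl, rfl⟩ := this
    have := M.disjoint.elim_finset hS.2 hT.2 b ha hb
    rw [this]

theorem parallel_toMatrix (e : I × V ↪ V') (M : CZLayer V) :
    parallel e M.toMatrix = (M.parallel e).toMatrix := by
  classical
  ext x y
  simp only [CZLayer.toMatrix_eq, parallel, Matrix.of_apply, Matrix.diagonal_apply]
  rw [CZLayer.sign_parallel]
  by_cases h : x = y
  · subst h; simp
  · rw [if_neg h]
    obtain ⟨v, hv⟩ := Function.ne_iff.1 h
    by_cases hr : v ∈ Set.range e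
    · obtain ⟨⟨i, u⟩, rfl⟩ := hr
      rw [Finset.prod_eq_zero (Finset.mem_univ i), zero_mul]
      rw [if_neg]
      intro hc
      exact hv (congrFun hc u)
    · rw [if_neg (fun hc => hv (hc v hr)), mul_zero]

/-- Running copies side by side is multiplicative and sends layers to layers, so any number of
copies costs the depth of one. -/
theorem Realizes.parallel {P : Finset V → Prop} {Q : Finset V' → Prop} (e : I × V ↪ V')
    (hPQ : ∀ i S, P S → Q (S.map ((Function.Embedding.sectR i V).trans e))) {d : ℕ}
    {A : Matrix (V → Bool) (V → Bool) ℂ} (h : Realizes P d A) :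
    Realizes Q d (parallel e A) := by
  induction h with
  | single L => rw [parallel_singleQubitLayer]; exact .single _
  | cz M h =>
    rw [parallel_toMatrix]
    refine .cz _ fun S hS => ?_
    simp only [CZLayer.parallel, Finset.mem_image, Finset.mem_product, Finset.mem_univ,
      true_and] at hS
    obtain ⟨q, hq, rfl⟩ := hS
    exact hPQ _ _ (h _ hq)
  | mul _ _ h₁ h₂ => rw [parallel_mul]; exact h₁.mul h₂

theorem parallel_mulVec_ket (e : I × V ↪ V') {A : Matrix (V → Bool) (V → Bool) ℂ}
    {x y : V' → Bool}
    (hA : ∀ i, A.mulVec (ket fun v => x (e (i, v))) = ket fun v => y (e (i, v)))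
    (hxy : ∀ v, v ∉ Set.range e → x v = y v) : (parallel e A).mulVec (ket x) = ket y := by
  classical
  ext z
  rw [mulVec_ket, ket_apply]
  simp only [parallel, Matrix.of_apply]
  have : ∀ i, A (fun v => z (e (i, v))) (fun v => x (e (i, v))) =
      if (fun v => z (e (i, v))) = fun v => y (e (i, v)) then 1 else 0 := by
    intro i
    rw [← mulVec_ket A, hA, ket_apply]
  simp only [this, Finset.prod_ite_zero, Finset.prod_const_one]
  rw [mul_ite, mul_one, mul_zero, ← ite_and]
  refine if_congr ⟨fun h => ?_, ?_⟩ rfl rfl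
  · ext v
    by_cases hv : v ∈ Set.range e
    · obtain ⟨⟨i, u⟩, rfl⟩ := hv
      exact congrFun (h.2 i (Finset.mem_univ i)) u
    · rw [h.1 v hv, hxy v hv]
  · rintro rfl
    exact ⟨fun v hv => (hxy v hv).symm, fun _ _ => rfl⟩

/-- The unitary that acts as `A` on the register `e` and as the identity on the other qubits. -/
noncomputable def extendUnitary (e : V ↪ V') (A : Matrix (V → Bool) (V → Bool) ℂ) :
    Matrix (V' → Bool) (V' → Bool) ℂ :=
  parallel ((Equiv.punitProd.{0} V).toEmbedding.trans e) A

theorem Realizes.extend {P : Finset V → Prop} {Q : Finset V' → Prop} (e : V ↪ V')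
    (hPQ : ∀ S, P S → Q (S.map e)) {d : ℕ}
    {A : Matrix (V → Bool) (V → Bool) ℂ} (h : Realizes P d A) :
    Realizes Q d (extendUnitary e A) :=
  h.parallel _ fun _ S hS => hPQ S hS

/-- The isometry that puts the register `V` on the qubits `e` of `V'`, all the other qubits being
in the basis state given by `ρ`. -/
noncomputable def placement (e : V ↪ V') (ρ : V' → Bool) : Matrix (V' → Bool) (V → Bool) ℂ :=
  Matrix.of fun z x => if z = Function.extend e x ρ then 1 else 0

theorem placement_mulVec_ket (e : V ↪ V') (ρ : V' → Bool) (x : V → Bool) :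
    (placement e ρ).mulVec (ket x) = ket (Function.extend e x ρ) := by
  ext z
  simp [ket, placement, Pi.single_apply]

theorem placement_mulVec_apply (e : V ↪ V') (ρ : V' → Bool) (φ : (V → Bool) → ℂ)
    (z : V' → Bool) : (placement e ρ).mulVec φ z = open Classical in
      if ∀ v, v ∉ Set.range e → z v = ρ v then φ fun v => z (e v) else 0 := by
  classical
  simp only [Matrix.mulVec, dotProduct, placement, Matrix.of_apply, ite_mul, one_mul, zero_mul]
  split_ifs with h
  · rw [Finset.sum_eq_single fun v => z (e v)]
    · rw [if_pos]
      ext v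
      by_cases hv : v ∈ Set.range e
      · obtain ⟨u, rfl⟩ := hv
        rw [e.injective.extend_apply]
      · rw [Function.extend_apply' _ _ _ (by simpa using hv), h v hv]
    · intro x _ hx
      rw [if_neg]
      rintro rfl
      exact hx (by ext v; rw [e.injective.extend_apply])
    · simp
  · refine Finset.sum_eq_zero fun x _ => if_neg ?_
    rintro rfl
    exact h fun v hv => Function.extend_apply' _ _ _ (by simpa using hv)

omit [DecidableEq V] in
theorem extendUnitary_apply (e : V ↪ V') (A : Matrix (V → Bool) (V → Bool) ℂ)
    (z y : V' → Bool) : extendUnitary e A z y = open Classical in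
      if ∀ v, v ∉ Set.range e → z v = y v then A (fun v => z (e v)) (fun v => y (e v)) else 0 := by
  classical
  have hr : Set.range ((Equiv.punitProd.{0} V).toEmbedding.trans e) = Set.range e := by
    ext v; simp
  simp [extendUnitary, parallel, hr]

/-- Spectator qubits in a fixed basis state are untouched. Relations of this intertwining shape
compose, and they are how circuits are moved between registers below. -/
theorem extendUnitary_mul_placement (e : V ↪ V') (A : Matrix (V → Bool) (V → Bool) ℂ)
    (ρ : V' → Bool) : extendUnitary e A * placement e ρ = placement e ρ * A := by
  classical
  refine matrix_ext_ket fun x => ?_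
  rw [← Matrix.mulVec_mulVec, ← Matrix.mulVec_mulVec, placement_mulVec_ket]
  ext z
  rw [placement_mulVec_apply, mulVec_ket, mulVec_ket, extendUnitary_apply]
  have h : ∀ v, v ∉ Set.range e → Function.extend e x ρ v = ρ v :=
    fun v hv => Function.extend_apply' _ _ _ (by simpa using hv)
  refine if_congr (forall₂_congr fun v hv => by rw [h v hv]) ?_ rfl
  simp only [e.injective.extend_apply]

end Parallel

/-! ### Gates -/

/-- The gate `X`. -/
noncomputable def gateX : Matrix.unitaryGroup Bool ℂ :=
  ⟨Matrix.of fun a b => if a = !b then 1 else 0, by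
    rw [Matrix.mem_unitaryGroup_iff]
    ext a b
    cases a <;> cases b <;>
      simp [Matrix.mul_apply, Matrix.star_apply]⟩

/-- The gate `Z`. -/
noncomputable def gateZ : Matrix.unitaryGroup Bool ℂ :=
  ⟨Matrix.diagonal fun a => if a then -1 else 1, by
    rw [Matrix.mem_unitaryGroup_iff]
    ext a b
    cases a <;> cases b <;>
      simp [Matrix.mul_apply, Matrix.star_apply]⟩

/-- The Hadamard gate. -/
noncomputable def gateH : Matrix.unitaryGroup Bool ℂ :=
  ⟨Matrix.of fun a b => (if a && b then -1 else 1) * ((√2)⁻¹ : ℂ), by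
    have h : ((√2 : ℝ) : ℂ)⁻¹ * ((√2 : ℝ) : ℂ)⁻¹ = 1 / 2 := by
      rw [← mul_inv, ← Complex.ofReal_mul, Real.mul_self_sqrt (by norm_num)]
      norm_num
    rw [Matrix.mem_unitaryGroup_iff]
    ext a b
    cases a <;> cases b <;>
      (simp [Matrix.mul_apply, Matrix.star_apply, h]; try norm_num)⟩

theorem gateX_apply (a b : Bool) :
    (gateX : Matrix Bool Bool ℂ) a b = if a = !b then 1 else 0 := rfl

theorem gateZ_apply (a b : Bool) :
    (gateZ : Matrix Bool Bool ℂ) a b = if a = b then (if a then -1 else 1) else 0 := rfl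

theorem gateH_apply (a b : Bool) :
    (gateH : Matrix Bool Bool ℂ) a b = (if a && b then -1 else 1) * ((√2)⁻¹ : ℂ) := rfl

theorem gateX_mul_self : gateX * gateX = 1 := by
  ext a b
  cases a <;> cases b <;> simp [Matrix.mul_apply, gateX_apply]

theorem gateH_mul_self : gateH * gateH = 1 := by
  have h : ((√2 : ℝ) : ℂ)⁻¹ * ((√2 : ℝ) : ℂ)⁻¹ = 1 / 2 := by
    rw [← mul_inv, ← Complex.ofReal_mul, Real.mul_self_sqrt (by norm_num)]
    norm_num
  ext a b
  cases a <;> cases b <;> (simp [Matrix.mul_apply, gateH_apply, h]; try norm_num)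

theorem gateH_mul_gateZ_mul_gateH : gateH * (gateZ * gateH) = gateX := by
  have h : ((√2 : ℝ) : ℂ)⁻¹ * ((√2 : ℝ) : ℂ)⁻¹ = 1 / 2 := by
    rw [← mul_inv, ← Complex.ofReal_mul, Real.mul_self_sqrt (by norm_num)]
    norm_num
  ext a b
  cases a <;> cases b <;>
    simp [Matrix.mul_apply, gateH_apply, gateZ_apply, gateX_apply, h] <;> norm_num

section Gates

variable {V : Type} [Fintype V] [DecidableEq V]

theorem mulVec_congr_support {W : Type} {A B : Matrix W (V → Bool) ℂ} {φ : (V → Bool) → ℂ}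
    (h : ∀ y, φ y ≠ 0 → A.mulVec (ket y) = B.mulVec (ket y)) : A.mulVec φ = B.mulVec φ := by
  ext z
  refine Finset.sum_congr rfl fun y _ => ?_
  by_cases hy : φ y = 0
  · simp [hy]
  · have := congrFun (h y hy) z
    simp only [ket, Matrix.mulVec_single_one, Matrix.col_apply] at this
    exact congrArg (· * φ y) this

theorem singleQubitLayer_mulVec_ket_eq {L : V → Matrix.unitaryGroup Bool ℂ} {x y : V → Bool}
    (h : ∀ v b, (L v : Matrix Bool Bool ℂ) b (x v) = if b = y v then 1 else 0) :
    (singleQubitLayer L).mulVec (ket x) = ket y := by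
  ext z
  rw [singleQubitLayer_mulVec_ket, ket_apply]
  simp only [h, Finset.prod_ite_zero, Finset.prod_const_one]
  exact if_congr (by simp [funext_iff]) rfl rfl

theorem flipLayer_mulVec_ket (f x : V → Bool) :
    (singleQubitLayer fun v => if f v then gateX else 1).mulVec (ket x) =
      ket fun v => xor (x v) (f v) := by
  refine singleQubitLayer_mulVec_ket_eq fun v b => ?_
  cases hf : f v <;> cases hx : x v <;> cases b <;> simp [gateX_apply]

theorem signLayer_mulVec_ket (f x : V → Bool) :
    (singleQubitLayer fun v => if f v then gateZ else 1).mulVec (ket x) =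
      (∏ v, if (f v && x v) = true then (-1 : ℂ) else 1) • ket x := by
  ext z
  rw [singleQubitLayer_mulVec_ket, Pi.smul_apply, ket_apply]
  by_cases h : z = x
  · subst h
    rw [if_pos rfl, smul_eq_mul, mul_one]
    refine Finset.prod_congr rfl fun v _ => ?_
    cases hf : f v <;> cases hx : z v <;> simp [gateZ_apply]
  · rw [if_neg h, smul_zero]
    obtain ⟨v, hv⟩ := Function.ne_iff.1 h
    refine Finset.prod_eq_zero (Finset.mem_univ v) ?_
    split_ifs <;> simp [gateZ_apply, hv]

/-- If `K` acts as a layer of single-qubit gates on all the basis states that occur in the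
product state obtained from `|x⟩`, then conjugation of `K` may be computed qubit by qubit. -/
theorem conj_singleQubitLayer_mulVec_ket {K : Matrix (V → Bool) (V → Bool) ℂ}
    {L' L Z : V → Matrix.unitaryGroup Bool ℂ} {x y : V → Bool}
    (hK : ∀ z, (∀ v, (L v : Matrix Bool Bool ℂ) (z v) (x v) ≠ 0) →
      K.mulVec (ket z) = (singleQubitLayer Z).mulVec (ket z))
    (hy : ∀ v b, (L' v * (Z v * L v) : Matrix Bool Bool ℂ) b (x v) =
      if b = y v then 1 else 0) :
    (singleQubitLayer L' * (K * singleQubitLayer L)).mulVec (ket x) = ket y := by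
  have h : K.mulVec ((singleQubitLayer L).mulVec (ket x)) =
      (singleQubitLayer Z).mulVec ((singleQubitLayer L).mulVec (ket x)) := by
    refine mulVec_congr_support fun z hz => ?_
    rw [singleQubitLayer_mulVec_ket] at hz
    exact hK z fun v => Finset.prod_ne_zero_iff.1 hz v (Finset.mem_univ v)
  rw [← Matrix.mulVec_mulVec, ← Matrix.mulVec_mulVec, h, Matrix.mulVec_mulVec,
    Matrix.mulVec_mulVec, ← singleQubitLayer_mul, ← singleQubitLayer_mul]
  refine singleQubitLayer_mulVec_ket_eq fun v b => ?_
  rw [← hy v b, ← Matrix.mul_assoc]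
  rfl

/-- Conjugating by X on the qubits where `pat` is 0 turns agreement with `pat` into being constantly
1. -/
theorem realizes_patterned {P : Finset V → Prop} (M : CZLayer V)
    (hM : ∀ S ∈ M.supports, P S) (pat : V → Bool) :
    Realizes P 1 (Matrix.diagonal fun x => M.sign fun v => x v == pat v) := by
  set X : Matrix (V → Bool) (V → Bool) ℂ :=
    singleQubitLayer fun v => if (!pat v) = true then gateX else 1 with hX
  have h : Matrix.diagonal (fun x => M.sign fun v => x v == pat v) = X * (M.toMatrix * X) := by
    refine matrix_ext_ket fun x => ?_
    rw [diagonal_mulVec_ket, ← Matrix.mulVec_mulVec, ← Matrix.mulVec_mulVec, hX,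
      flipLayer_mulVec_ket, M.toMatrix_eq, diagonal_mulVec_ket, Matrix.mulVec_smul,
      flipLayer_mulVec_ket]
    congr 2
    · ext v; cases x v <;> cases pat v <;> rfl
    · ext v; cases x v <;> cases pat v <;> rfl
  rw [h]
  simpa using (Realizes.single (P := P) _).mul ((Realizes.cz M hM).mul (Realizes.single _))

/-- The phase `-1` on the basis states that agree with `pat` on the nonempty set `S`. -/
theorem realizes_phase {P : Finset V → Prop} (S : Finset V) (hS : S.Nonempty) (hP : P S)
    (pat : V → Bool) :
    Realizes P 1 (Matrix.diagonal fun x => if ∀ v ∈ S, x v = pat v then (-1 : ℂ) else 1) := by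
  have := realizes_patterned (P := P) (⟨{S}, by simpa, by simp⟩ : CZLayer V) (by simpa) pat
  simpa [CZLayer.sign] using this

/-- The layer of `CZ` gates given by an indexed family of disjoint supports. -/
def CZLayer.ofFamily {I : Type} [Fintype I] (S : I → Finset V) (hS : ∀ i, (S i).Nonempty)
    (hd : ∀ i j, i ≠ j → Disjoint (S i) (S j)) : CZLayer V where
  supports := Finset.univ.image S
  nonempty := by simpa using hS
  disjoint := by
    rintro A hA B hB hAB
    simp only [Finset.coe_image, Set.mem_image] at hA hB
    obtain ⟨i, -, rfl⟩ := hA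
    obtain ⟨j, -, rfl⟩ := hB
    exact hd i j fun h => hAB (by rw [h])

theorem CZLayer.sign_ofFamily {I : Type} [Fintype I] (S : I → Finset V)
    (hS : ∀ i, (S i).Nonempty) (hd : ∀ i j, i ≠ j → Disjoint (S i) (S j)) (x : V → Bool) :
    (CZLayer.ofFamily S hS hd).sign x =
      ∏ i, if ∀ v ∈ S i, x v = true then (-1 : ℂ) else 1 := by
  rw [CZLayer.sign, CZLayer.ofFamily, Finset.prod_image]
  intro i _ j _ hij
  by_contra hne
  have := hd i j hne
  rw [← hij, disjoint_self] at this
  exact (hS i).ne_empty this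

/-- Controlled-`X` gates from `s i` to `t i` along the disjoint segments `S i`, provided that the
other qubits of the segments are in the state `|0⟩`. -/
theorem exists_copy {P : Finset V → Prop} {I : Type} [Fintype I] (S : I → Finset V)
    (s t : I → V) (hs : ∀ i, s i ∈ S i) (ht : ∀ i, t i ∈ S i) (hst : ∀ i, s i ≠ t i)
    (hd : ∀ i j, i ≠ j → Disjoint (S i) (S j)) (hP : ∀ i, P (S i)) :
    ∃ A, Realizes P 1 A ∧ ∀ x : V → Bool,
      (∀ i, ∀ v ∈ S i, v ≠ s i → v ≠ t i → x v = false) →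
      A.mulVec (ket x) = ket fun v => xor (x v)
        (open Classical in decide (∃ i, v = t i ∧ x (s i) = true)) := by
  classical
  have hS : ∀ i, (S i).Nonempty := fun i => ⟨_, hs i⟩
  have hinj : ∀ {i j v}, v ∈ S i → v ∈ S j → i = j := fun {i j v} hi hj =>
    by_contra fun hne => Finset.disjoint_left.1 (hd i j hne) hi hj
  have hst' : ∀ i j, s i ≠ t j := by
    intro i j h
    obtain rfl := hinj (hs i) (h ▸ ht j)
    exact hst i h
  have htinj : Function.Injective t := fun i j h => hinj (ht i) (h ▸ ht j)
  set M := CZLayer.ofFamily S hS hd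
  -- X raises the intermediate qubits from 0 to 1, so the long gate reduces to CZ between source and
  -- target. The Hadamard gates turn it into a controlled X on the target.
  set Lay : V → Matrix.unitaryGroup Bool ℂ := fun v =>
    if ∃ i, v = t i then gateH else if ∃ i, v ∈ S i ∧ v ≠ s i then gateX else 1 with hL
  refine ⟨singleQubitLayer Lay * (M.toMatrix * singleQubitLayer Lay), ?_, fun x hx => ?_⟩
  · refine (Realizes.single (P := P) _).mul ((Realizes.cz M ?_).mul (Realizes.single _))
    intro A hA
    simp only [M, CZLayer.ofFamily, Finset.mem_image, Finset.mem_univ, true_and] at hA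
    obtain ⟨i, rfl⟩ := hA
    exact hP i
  -- Once the source bits are known, the CZ layer is just Z on the targets whose source is 1.
  set q : V → Bool := fun v => decide (∃ i, v = t i ∧ x (s i) = true) with hq
  refine conj_singleQubitLayer_mulVec_ket (Z := fun v => if q v then gateZ else 1) ?_ ?_
  · intro z hz
    have hzs : ∀ i, z (s i) = x (s i) := by
      intro i
      have := hz (s i)
      have h1 : Lay (s i) = 1 := by
        rw [hL]
        simp only
        rw [if_neg (fun ⟨j, hj⟩ => hst' i j hj), if_neg]
        rintro ⟨j, hj, hne⟩
        obtain rfl := hinj hj (hs i)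
        exact hne rfl
      rw [h1] at this
      by_contra hc
      exact this (by simp [hc])
    have hzm : ∀ i, ∀ v ∈ S i, v ≠ s i → v ≠ t i → z v = true := by
      intro i v hv h1 h2
      have := hz v
      have h3 : Lay v = gateX := by
        rw [hL]
        simp only
        rw [if_neg, if_pos ⟨i, hv, h1⟩]
        rintro ⟨j, rfl⟩
        obtain rfl := hinj hv (ht j)
        exact h2 rfl
      rw [h3, gateX_apply, hx i v hv h1 h2] at this
      by_contra hc
      exact this (by simpa using hc)
    rw [M.toMatrix_eq, diagonal_mulVec_ket, signLayer_mulVec_ket]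
    congr 1
    rw [CZLayer.sign_ofFamily]
    refine Fintype.prod_of_injective t htinj _ _ ?_ ?_
    · intro v hv
      rw [if_neg]
      simp only [hq, Bool.and_eq_true, decide_eq_true_eq, not_and]
      rintro ⟨i, rfl, -⟩
      exact absurd ⟨i, rfl⟩ hv
    · intro i
      refine if_congr ?_ rfl rfl
      simp only [hq, Bool.and_eq_true, decide_eq_true_eq]
      constructor
      · intro h
        exact ⟨⟨i, rfl, hzs i ▸ h _ (hs i)⟩, h _ (ht i)⟩
      · rintro ⟨⟨j, hj, h1⟩, h2⟩ v hv
        obtain rfl := htinj hj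
        by_cases h3 : v = s i
        · rw [h3, hzs, h1]
        · by_cases h4 : v = t i
          · rw [h4, h2]
          · exact hzm i v hv h3 h4
  · intro v b
    change _ = if b = xor (x v) (q v) then (1 : ℂ) else 0
    by_cases h1 : ∃ i, v = t i
    · have h3 : Lay v = gateH := if_pos h1
      simp only [h3]
      cases hqv : q v
      · simp only [Bool.false_eq_true, if_false]
        have : (gateH : Matrix Bool Bool ℂ) * gateH = 1 := congrArg Subtype.val gateH_mul_self
        simp [this, Matrix.one_apply]
      · have : (gateH : Matrix Bool Bool ℂ) * (gateZ * gateH) = gateX :=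
          congrArg Subtype.val gateH_mul_gateZ_mul_gateH
        simp [this, gateX_apply]
    · have hqv : q v = false := by
        simp only [hq, decide_eq_false_iff_not]
        rintro ⟨i, hi, -⟩
        exact h1 ⟨i, hi⟩
      by_cases h2 : ∃ i, v ∈ S i ∧ v ≠ s i
      · have h3 : Lay v = gateX := by rw [hL]; simp only; rw [if_neg h1, if_pos h2]
        have : (gateX : Matrix Bool Bool ℂ) * gateX = 1 := congrArg Subtype.val gateX_mul_self
        simp [h3, hqv, this, Matrix.one_apply]
      · have h3 : Lay v = 1 := by rw [hL]; simp only; rw [if_neg h1, if_neg h2]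
        simp [h3, hqv, Matrix.one_apply]

end Gates

/-! ### Exact cat states -/

/-- A unit vector (u, v) is completed to a unitary by the second column (-v̄, ū). -/
theorem exists_unitary_column (u v : ℂ) (h : ‖u‖ ^ 2 + ‖v‖ ^ 2 = 1) :
    ∃ U : Matrix.unitaryGroup Bool ℂ,
      (U : Matrix Bool Bool ℂ) false false = u ∧ (U : Matrix Bool Bool ℂ) true false = v := by
  have h' : u * star u + v * star v = 1 := by
    have := congrArg (fun r : ℝ => (r : ℂ)) h
    simpa [Complex.mul_conj, Complex.normSq_eq_norm_sq] using this
  refine ⟨⟨Matrix.of fun a b =>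
    if b then (if a then star u else -star v) else (if a then v else u), ?_⟩, rfl, rfl⟩
  rw [Matrix.mem_unitaryGroup_iff]
  ext a b
  simp only [Complex.star_def] at h'
  cases a <;> cases b <;>
    simp [Matrix.mul_apply, Matrix.star_apply] <;> first | linear_combination h' | ring

section Grover

variable {V : Type} [Fintype V] [DecidableEq V]

theorem star_ket_dotProduct (x : V → Bool) (φ : (V → Bool) → ℂ) : star (ket x) ⬝ᵥ φ = φ x := by
  simp [ket]

theorem dotProduct_ket (x : V → Bool) (φ : (V → Bool) → ℂ) : φ ⬝ᵥ ket x = φ x := by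
  simp [ket]

/-- Exact amplitude amplification towards the span of two basis states. -/
theorem exists_amplified {d j : ℕ} (hj : 1 ≤ j) {A : Matrix (V → Bool) (V → Bool) ℂ}
    (hA : Realizes (fun _ => True) d A) {o g₀ g₁ : V → Bool} (hg : g₀ ≠ g₁) {t : ℝ}
    (h₀ : A g₀ o = t) (h₁ : A g₁ o = t) (ht : √2 * t = Real.sin (Real.pi / (2 * (2 * j + 1)))) :
    ∃ (B : Matrix (V → Bool) (V → Bool) ℂ) (α : ℂ),
      Realizes (fun _ => True) (j * (2 * d + 3) + d) B ∧
        B.mulVec (ket o) = α • (ket g₀ + ket g₁) := by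
  have hV : (Finset.univ : Finset V).Nonempty := by
    obtain ⟨v, -⟩ := Function.ne_iff.1 hg
    exact ⟨v, Finset.mem_univ v⟩
  set S : (V → Bool) → Matrix (V → Bool) (V → Bool) ℂ := fun g =>
    Matrix.diagonal fun x => if ∀ v ∈ Finset.univ, x v = g v then (-1 : ℂ) else 1 with hS
  have hSr : ∀ g, Realizes (fun _ => True) 1 (S g) := fun g =>
    realizes_phase Finset.univ hV trivial g
  have hSv : ∀ g φ z, (S g).mulVec φ z = if z = g then -φ z else φ z := by
    intro g φ z
    rw [hS, Matrix.mulVec_diagonal]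
    rw [if_congr (show (∀ v ∈ Finset.univ, z v = g v) ↔ z = g by simp [funext_iff]) rfl rfl]
    split_ifs <;> simp
  set ψ := A.mulVec (ket o) with hψ
  have hψz : ∀ z, ψ z = A z o := fun z => mulVec_ket A o z
  set κ : (V → Bool) → ℂ := ket g₀ + ket g₁ with hκ
  -- The part of ψ orthogonal to both basis states. The plane spanned by κ and β is invariant under
  -- the Grover iterate; both vectors are left unnormalized.
  set β : (V → Bool) → ℂ := ψ - (t : ℂ) • κ with hβ
  have hκ₀ : κ g₀ = 1 := by simp [hκ, ket_apply, hg]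
  have hκ₁ : κ g₁ = 1 := by simp [hκ, ket_apply, hg.symm]
  have hκz : ∀ z, z ≠ g₀ → z ≠ g₁ → κ z = 0 := fun z h h' => by simp [hκ, ket_apply, h, h']
  have hβ₀ : β g₀ = 0 := by simp [hβ, hκ₀, hψz, h₀]
  have hβ₁ : β g₁ = 0 := by simp [hβ, hκ₁, hψz, h₁]
  have hψκ : star ψ ⬝ᵥ κ = 2 * t := by
    rw [hκ, dotProduct_add, dotProduct_ket, dotProduct_ket]
    simp [hψz, h₀, h₁]; ring
  have hψψ : star ψ ⬝ᵥ ψ = 1 := by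
    rw [hψ, hA.dotProduct_mulVec, star_ket_dotProduct, ket_apply, if_pos rfl]
  have hψβ : star ψ ⬝ᵥ β = 1 - 2 * t ^ 2 := by
    rw [hβ, dotProduct_sub, dotProduct_smul, hψκ, hψψ, smul_eq_mul]; ring
  have hAA : ∀ φ, A.mulVec (A.conjTranspose.mulVec φ) = φ := fun φ => by
    rw [Matrix.mulVec_mulVec, mul_eq_one_comm.1 hA.conjTranspose_mul_self, Matrix.one_mulVec]
  have hR : ∀ φ, A.mulVec ((S o).mulVec (A.conjTranspose.mulVec φ)) =
      φ - (2 * (star ψ ⬝ᵥ φ)) • ψ := by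
    intro φ
    have h1 : (A.conjTranspose.mulVec φ) o = star ψ ⬝ᵥ φ := by
      simp only [Matrix.mulVec, dotProduct, Matrix.conjTranspose_apply, Pi.star_apply, hψz]
    have h2 : (S o).mulVec (A.conjTranspose.mulVec φ) =
        A.conjTranspose.mulVec φ - (2 * (star ψ ⬝ᵥ φ)) • ket o := by
      ext z
      rw [hSv, Pi.sub_apply, Pi.smul_apply, ket_apply]
      split_ifs with h
      · rw [h, h1, smul_eq_mul]; ring
      · simp
    rw [h2, Matrix.mulVec_sub, Matrix.mulVec_smul, hAA]
  -- The Grover iterate: two phase flips at the good states, then the reflection 1 - 2|ψ⟩⟨ψ|. It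
  -- uses three CZ layers besides `A` and its adjoint.
  set G := A * (S o * (A.conjTranspose * (S g₀ * S g₁))) with hG
  have hGr : Realizes (fun _ => True) (2 * d + 3) G := by
    have := hA.mul ((hSr o).mul (hA.conjTranspose.mul ((hSr g₀).mul (hSr g₁))))
    convert this using 1
    ring
  have hstep : ∀ a b : ℂ, G.mulVec (a • κ + b • β) =
      -((a * (1 - 4 * t ^ 2) + 2 * t * (1 - 2 * t ^ 2) * b) • κ +
        (b * (1 - 4 * t ^ 2) - 4 * t * a) • β) := by
    intro a b
    have h1 : (S g₀).mulVec ((S g₁).mulVec (a • κ + b • β)) = (-a) • κ + b • β := by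
      ext z
      rw [hSv, hSv]
      by_cases hz0 : z = g₀
      · subst hz0; simp [hg, hκ₀, hβ₀]
      · by_cases hz1 : z = g₁
        · subst hz1; simp [hz0, hκ₁, hβ₁]
        · simp [hz0, hz1, hκz]
    have hψ' : ψ = (t : ℂ) • κ + β := by rw [hβ]; abel
    rw [hG]
    simp only [← Matrix.mulVec_mulVec]
    rw [h1, hR, dotProduct_add, dotProduct_smul, dotProduct_smul, hψκ, hψβ]
    nth_rw 1 [hψ']
    simp only [smul_eq_mul]
    module
  set θ : ℝ := Real.pi / (2 * (2 * j + 1)) with hθ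
  have hj0 : (0 : ℝ) < 2 * j + 1 := by positivity
  -- Here 1 ≤ j matters: for j = 0 the angle would be π/2 and the division by cos θ below would
  -- fail.
  have hcos : 0 < Real.cos θ := by
    refine Real.cos_pos_of_mem_Ioo ⟨?_, ?_⟩
    · have : 0 < θ := by positivity
      linarith [Real.pi_pos]
    · rw [hθ]
      refine div_lt_div_of_pos_left Real.pi_pos (by norm_num) ?_
      have : (1 : ℝ) ≤ j := by exact_mod_cast hj
      linarith
  have h2 : (√2 : ℝ) * √2 = 2 := Real.mul_self_sqrt (by norm_num)
  have h2' : (√2 : ℝ) ≠ 0 := by positivity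
  have htsq : t ^ 2 = Real.sin θ ^ 2 / 2 := by
    rw [← ht, mul_pow, sq √2, h2]; ring
  have hte : t = Real.sin θ / √2 := by rw [← ht]; field_simp
  have hc2 : Real.cos θ ^ 2 = 1 - 2 * t ^ 2 := by
    rw [htsq, Real.cos_sq']; ring
  -- Up to sign each iteration rotates by 2θ, starting at angle θ because tκ has norm √2·t = sin θ.
  -- At k = j the angle is π/2 and the β-component vanishes.
  have hiter : ∀ k : ℕ, (G ^ k * A).mulVec (ket o) = ((-1 : ℂ) ^ k) •
      (((Real.sin ((2 * k + 1) * θ) / √2 : ℝ) : ℂ) • κ +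
        ((Real.cos ((2 * k + 1) * θ) / Real.cos θ : ℝ) : ℂ) • β) := by
    intro k
    induction k with
    | zero =>
      simp only [pow_zero, one_mul, ← hψ, Nat.cast_zero, mul_zero, zero_add, one_smul]
      rw [← hte, div_self hcos.ne', Complex.ofReal_one, one_smul, hβ]
      abel
    | succ k ih =>
      rw [pow_succ', Matrix.mul_assoc, ← Matrix.mulVec_mulVec, ih, Matrix.mulVec_smul, hstep,
        smul_neg, ← neg_smul, pow_succ (-1 : ℂ) k, mul_neg_one]
      set a := (2 * (k : ℝ) + 1) * θ with ha
      have hang : (2 * ((k + 1 : ℕ) : ℝ) + 1) * θ = a + 2 * θ := by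
        rw [ha]; push_cast; ring
      rw [hang, Real.sin_add, Real.cos_add, Real.sin_two_mul, Real.cos_two_mul', Real.cos_sq',
        hte]
      have hs : (Real.sin θ / √2) ^ 2 = Real.sin θ ^ 2 / 2 := by rw [← hte, htsq]
      have e1 : (Real.sin a * (1 - Real.sin θ ^ 2 - Real.sin θ ^ 2) +
            Real.cos a * (2 * Real.sin θ * Real.cos θ)) / √2 =
          Real.sin a / √2 * (1 - 4 * (Real.sin θ / √2) ^ 2) +
            2 * (Real.sin θ / √2) * (1 - 2 * (Real.sin θ / √2) ^ 2) *
              (Real.cos a / Real.cos θ) := by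
        have hc : 1 - 2 * (Real.sin θ / √2) ^ 2 = Real.cos θ ^ 2 := by rw [← hte, hc2]
        rw [hc, hs]
        field_simp
        ring
      have e2 : (Real.cos a * (1 - Real.sin θ ^ 2 - Real.sin θ ^ 2) -
            Real.sin a * (2 * Real.sin θ * Real.cos θ)) / Real.cos θ =
          Real.cos a / Real.cos θ * (1 - 4 * (Real.sin θ / √2) ^ 2) -
            4 * (Real.sin θ / √2) * (Real.sin a / √2) := by
        rw [hs]
        have h4 : 4 * (Real.sin θ / √2) * (Real.sin a / √2) = 2 * Real.sin θ * Real.sin a := by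
          have : 4 * (Real.sin θ / √2) * (Real.sin a / √2) =
              4 * Real.sin θ * Real.sin a / (√2 * √2) := by ring
          rw [this, h2]; ring
        rw [h4]
        field_simp
        ring
      rw [e1, e2]
      push_cast
      rfl
  refine ⟨G ^ j * A, (-1) ^ j * (((√2 : ℝ)⁻¹ : ℝ) : ℂ), Realizes.mul ?_ hA, ?_⟩
  · clear_value G
    clear hj hj0 hθ ht hiter hcos hte htsq hc2
    clear θ
    induction j with
    | zero => simpa using Realizes.one
    | succ k ih => rw [pow_succ, add_mul, one_mul]; exact ih.mul hGr
  · rw [hiter]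
    have : (2 * (j : ℝ) + 1) * θ = Real.pi / 2 := by rw [hθ]; field_simp
    rw [this, Real.sin_pi_div_two, Real.cos_pi_div_two]
    simp [mul_smul]

end Grover

section Cat

variable {V : Type} [Fintype V] [DecidableEq V]

theorem extendUnitary_mul_singleQubitLayer_apply (A : Matrix (V → Bool) (V → Bool) ℂ)
    (U : Bool → Matrix.unitaryGroup Bool ℂ) (x : V → Bool) (y : Bool → Bool) :
    (extendUnitary (Function.Embedding.inl : V ↪ V ⊕ Bool) A *
      singleQubitLayer (Sum.elim (fun _ : V => 1) U) :
        Matrix (V ⊕ Bool → Bool) (V ⊕ Bool → Bool) ℂ) (Sum.elim x y) (fun _ => false) =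
      A x (fun _ => false) * ((U false : Matrix Bool Bool ℂ) (y false) false *
        (U true : Matrix Bool Bool ℂ) (y true) false) := by
  classical
  have hL : ∀ w : V ⊕ Bool → Bool,
      singleQubitLayer (Sum.elim (fun _ : V => 1) U) w (fun _ => false) =
        (if (fun v => w (Sum.inl v)) = fun _ => false then 1 else 0) *
        ((U false : Matrix Bool Bool ℂ) (w (Sum.inr false)) false *
          (U true : Matrix Bool Bool ℂ) (w (Sum.inr true)) false) := by
    intro w
    simp only [singleQubitLayer, Matrix.of_apply, Fintype.prod_sum_type, Sum.elim_inl,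
      Sum.elim_inr, OneMemClass.coe_one, Matrix.one_apply, Finset.prod_ite_zero,
      Finset.prod_const_one, Finset.mem_univ, true_imp_iff, funext_iff, Fintype.prod_bool]
    ring
  rw [Matrix.mul_apply, Finset.sum_eq_single (Sum.elim (fun _ => false) y)]
  · rw [hL, extendUnitary_apply, if_pos]
    · simp
    · rintro (v | b) hv
      · exact absurd ⟨v, rfl⟩ hv
      · rfl
  · intro w _ hw
    rw [hL, extendUnitary_apply]
    by_cases h1 : ∀ v, v ∉ Set.range (Function.Embedding.inl : V ↪ V ⊕ Bool) →
        Sum.elim x y v = w v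
    · rw [if_neg (c := (fun v => w (Sum.inl v)) = fun _ => false), zero_mul, mul_zero]
      intro h2
      refine hw (funext ?_)
      rintro (v | b)
      · exact congrFun h2 v
      · exact (h1 (Sum.inr b) (by simp)).symm
    · rw [if_neg h1, zero_mul]
  · simp

/-- If the amplitudes of two basis states are bounded below, then, with the help of two more
qubits, they can be amplified to an exact superposition with equal weights. -/
theorem exists_superposition {d j : ℕ} (hj : 1 ≤ j) {A : Matrix (V → Bool) (V → Bool) ℂ}
    (hA : Realizes (fun _ => True) d A) {g : V → Bool} {δ : ℝ} (hδ : 0 < δ)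
    (hjδ : Real.sin (Real.pi / (2 * (2 * j + 1))) ≤ δ)
    (h₀ : δ ≤ ‖A (fun _ => false) (fun _ => false)‖) (h₁ : δ ≤ ‖A g (fun _ => false)‖) :
    ∃ (B : Matrix (V ⊕ Bool → Bool) (V ⊕ Bool → Bool) ℂ) (α : ℂ) (b : Bool → Bool),
      Realizes (fun _ => True) (j * (2 * d + 3) + d) B ∧
        B.mulVec (ket fun _ => false) = α • (ket (fun _ => false) + ket (Sum.elim g b)) := by
  set a₀ := A (fun _ => false) (fun _ => false)
  set a₁ := A g (fun _ => false)
  have h₀' : 0 < ‖a₀‖ := hδ.trans_le h₀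
  have h₁' : 0 < ‖a₁‖ := hδ.trans_le h₁
  -- Normalizes the vector (1/a₀, 1/a₁), the state of the first extra qubit.
  set s : ℝ := 1 / ‖a₀‖ ^ 2 + 1 / ‖a₁‖ ^ 2 with hs
  have hs0 : 0 < s := by positivity
  have hsδ : s ≤ 2 / δ ^ 2 := by
    have e1 : 1 / ‖a₀‖ ^ 2 ≤ 1 / δ ^ 2 := by gcongr
    have e2 : 1 / ‖a₁‖ ^ 2 ≤ 1 / δ ^ 2 := by gcongr
    calc s ≤ 1 / δ ^ 2 + 1 / δ ^ 2 := add_le_add e1 e2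
      _ = 2 / δ ^ 2 := by ring
  set σ := Real.sin (Real.pi / (2 * (2 * j + 1))) with hσ
  have hσ0 : 0 ≤ σ := by
    refine Real.sin_nonneg_of_nonneg_of_le_pi (by positivity) ?_
    refine div_le_self Real.pi_pos.le ?_
    have : (0 : ℝ) ≤ j := by positivity
    linarith
  set t : ℝ := σ / √2 with ht
  have h2 : (√2 : ℝ) * √2 = 2 := Real.mul_self_sqrt (by norm_num)
  have ht2 : t ^ 2 = σ ^ 2 / 2 := by rw [ht, div_pow, sq √2, h2]
  have hss : √s * √s = s := Real.mul_self_sqrt hs0.le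
  -- The lower bound δ enters here: the common amplitude 1/√s must be at least t, since it can only
  -- be reduced.
  have hr : (t * √s) ^ 2 ≤ 1 := by
    rw [mul_pow, sq √s, hss, ht2]
    calc σ ^ 2 / 2 * s ≤ δ ^ 2 / 2 * (2 / δ ^ 2) := by gcongr
      _ = 1 := by field_simp
  -- Multiplying a₀ and a₁ by these entries makes both equal to 1/√s, phases included.
  obtain ⟨U₀, hU₀, hU₀'⟩ := exists_unitary_column (((√s)⁻¹ : ℝ) / a₀) (((√s)⁻¹ : ℝ) / a₁) (by
    rw [norm_div, norm_div, Complex.norm_real, Real.norm_of_nonneg (by positivity), div_pow,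
      div_pow, inv_pow, sq √s, hss]
    have : s⁻¹ / ‖a₀‖ ^ 2 + s⁻¹ / ‖a₁‖ ^ 2 = s⁻¹ * s := by rw [hs]; ring
    rw [this, inv_mul_cancel₀ hs0.ne'])
  -- The second extra qubit, taken at 0, scales the common amplitude from 1/√s to exactly t.
  obtain ⟨U₁, hU₁, -⟩ := exists_unitary_column ((t * √s : ℝ) : ℂ)
    ((√(1 - (t * √s) ^ 2) : ℝ) : ℂ) (by
    rw [Complex.norm_real, Complex.norm_real, Real.norm_eq_abs, Real.norm_eq_abs, sq_abs, sq_abs,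
      Real.sq_sqrt (by linarith)]
    ring)
  have hne₀ : a₀ ≠ 0 := norm_pos_iff.1 h₀'
  have hne₁ : a₁ ≠ 0 := norm_pos_iff.1 h₁'
  have hsne : ((√s : ℝ) : ℂ) ≠ 0 := by
    rw [Complex.ofReal_ne_zero]; positivity
  set U : Bool → Matrix.unitaryGroup Bool ℂ := fun c => if c then U₁ else U₀ with hU
  have hB := (hA.extend (Q := fun _ => True) (Function.Embedding.inl : V ↪ V ⊕ Bool)
    (fun _ _ => trivial)).mul (Realizes.single (Sum.elim (fun _ : V => 1) U))
  rw [add_zero] at hB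
  obtain ⟨B, α, hBr, hBv⟩ := exists_amplified hj hB (o := fun _ => false)
    (g₀ := Sum.elim (fun _ => false) fun _ => false) (g₁ := Sum.elim g fun c => !c) (t := t)
    (fun h => by simpa using congrFun h (Sum.inr false))
    (by
      rw [extendUnitary_mul_singleQubitLayer_apply]
      simp only [hU, Bool.false_eq_true, if_false, if_true, hU₀, hU₁]
      change a₀ * _ = _
      push_cast
      field_simp)
    (by
      rw [extendUnitary_mul_singleQubitLayer_apply]
      simp only [hU, Bool.false_eq_true, if_false, if_true, Bool.not_false, Bool.not_true,
        hU₀', hU₁]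
      change a₁ * _ = _
      push_cast
      field_simp)
    (by rw [ht, ← hσ]; field_simp)
  refine ⟨B, α, fun c => !c, hBr, ?_⟩
  rw [hBv]
  congr 3
  ext v
  rcases v with v | v <;> rfl

end Cat

theorem exists_grover_angle_le {δ : ℝ} (hδ : 0 < δ) :
    ∃ j : ℕ, 1 ≤ j ∧ Real.sin (Real.pi / (2 * (2 * j + 1))) ≤ δ := by
  obtain ⟨k, hk⟩ := exists_nat_gt (Real.pi / δ)
  refine ⟨k + 1, by omega, (Real.sin_le (by positivity)).trans ?_⟩
  rw [div_lt_iff₀ hδ] at hk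
  rw [div_le_iff₀ (by positivity)]
  push_cast
  have : (0 : ℝ) ≤ k := by positivity
  nlinarith

theorem Realizes.isPureState_mulVec {V : Type} [Fintype V] [DecidableEq V]
    {P : Finset V → Prop} {d : ℕ} {A : Matrix (V → Bool) (V → Bool) ℂ} (hA : Realizes P d A)
    (x : V → Bool) : IsPureState (A.mulVec (ket x)) := by
  have h := hA.dotProduct_mulVec (ket x) (ket x)
  rw [star_ket_dotProduct, ket_apply, if_pos rfl] at h
  rw [IsPureState, ← Complex.ofReal_inj, ← Complex.ofReal_one] at *
  rw [← h]
  push_cast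
  refine Finset.sum_congr rfl fun z _ => ?_
  rw [Pi.star_apply, mul_comm, Complex.star_def, Complex.mul_conj, Complex.normSq_eq_norm_sq]
  push_cast
  rfl

/-! ### Cat amplitudes from an approximate parity circuit -/

section Approx

variable {n a : ℕ}

theorem prod_sign_eq_parityBit (x : Fin n → Bool) :
    (∏ i, if x i = true then (-1 : ℂ) else 1) = if parityBit x then -1 else 1 := by
  rw [Finset.prod_ite, Finset.prod_const, Finset.prod_const_one, mul_one, parityBit]
  by_cases h : Odd (Finset.univ.filter fun i => x i = true).card
  · simp [h, h.neg_one_pow]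
  · simp [h, (Nat.not_odd_iff_even.1 h).neg_one_pow]

theorem withAncilla_inl {V W : Type} [Fintype V] [DecidableEq V] [Fintype W] [DecidableEq W]
    (φ : (W → Bool) → ℂ) (z : W ⊕ V → Bool) :
    withAncilla Function.Embedding.inl φ z =
      if (fun v => z (Sum.inr v)) = (fun _ => false) then φ fun w => z (Sum.inl w) else 0 := by
  refine if_congr ?_ rfl rfl
  simp [funext_iff]

theorem parityUnitary_mulVec (φ : (Fin n ⊕ Unit → Bool) → ℂ) (y : Fin n ⊕ Unit → Bool) :
    (parityUnitary n).mulVec φ y = φ (Sum.elim (fun i => y (Sum.inl i))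
      fun _ => xor (y (Sum.inr ())) (parityBit fun i => y (Sum.inl i))) := by
  simp only [Matrix.mulVec, dotProduct, parityUnitary, Matrix.of_apply, ite_mul, one_mul, zero_mul]
  rw [Finset.sum_eq_single (Sum.elim (fun i => y (Sum.inl i))
      fun _ => xor (y (Sum.inr ())) (parityBit fun i => y (Sum.inl i)))]
  · rw [if_pos]
    ext v
    rcases v with v | v <;> simp
  · intro z _ hz
    rw [if_neg]
    rintro rfl
    refine hz ?_
    ext v
    rcases v with v | v <;> simp
  · simp

/-- The basis state of a register with the input and target qubits in the state `|1⟩` and the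
ancillas in the state `|0⟩`. -/
def onesState (n a : ℕ) : (Fin n ⊕ Unit) ⊕ Fin a → Bool :=
  Sum.elim (fun _ => true) fun _ => false

/-- Conjugated by Hadamard gates, parity on uniform inputs and target 0 prepares (|0…0⟩ + |1…1⟩)/√2.
The fidelity is therefore half the squared modulus of the sum of the two amplitudes of A, and
neither amplitude exceeds 1. -/
theorem exists_cat_amplitudes {p : ℝ}
    (C : QACCircuit ((Fin n ⊕ Unit) ⊕ Fin a))
    (hC : SolvesApproxClean p C Function.Embedding.inl (parityUnitary n)) :
    ∃ A, Realizes (fun _ => True) C.depth A ∧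
      √(2 * p) - 1 ≤ ‖A (fun _ => false) fun _ => false‖ ∧
      √(2 * p) - 1 ≤ ‖A (onesState n a) fun _ => false‖ := by
  set r : ℂ := ((√2 : ℝ) : ℂ)⁻¹ with hr
  have h2 : (√2 : ℝ) * √2 = 2 := Real.mul_self_sqrt (by norm_num)
  have hrr : r * r = 1 / 2 := by
    rw [hr, ← mul_inv, ← Complex.ofReal_mul, h2]; norm_num
  have hrn : ‖r‖ ^ 2 = 1 / 2 := by
    rw [hr, norm_inv, Complex.norm_real, Real.norm_of_nonneg (by positivity), inv_pow, sq √2, h2]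
    norm_num
  set L₁ : (Fin n ⊕ Unit) ⊕ Fin a → Matrix.unitaryGroup Bool ℂ :=
    Sum.elim (fun _ => gateH) fun _ => 1 with hL₁
  set L₂ : (Fin n ⊕ Unit) ⊕ Fin a → Matrix.unitaryGroup Bool ℂ :=
    Sum.elim (Sum.elim (fun _ => gateH) fun _ => 1) fun _ => 1 with hL₂
  set φ : (Fin n ⊕ Unit → Bool) → ℂ := fun w => if w (Sum.inr ()) = false then r ^ n else 0
    with hφ
  have hin : (singleQubitLayer L₂).mulVec (ket fun _ => false) =
      withAncilla Function.Embedding.inl φ := by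
    ext z
    rw [singleQubitLayer_mulVec_ket, withAncilla_inl, hφ]
    simp only [Fintype.prod_sum_type, hL₂, Sum.elim_inl, Sum.elim_inr, OneMemClass.coe_one,
      Matrix.one_apply, gateH_apply, Bool.and_false, Bool.false_eq_true, if_false, one_mul,
      Finset.prod_const, Finset.card_univ, Fintype.card_fin, Finset.prod_ite_zero,
      one_pow, Fintype.card_unit, Finset.mem_univ, true_imp_iff, funext_iff]
    split_ifs <;> simp_all
  have hout : withAncilla Function.Embedding.inl ((parityUnitary n).mulVec φ) =
      r • ((singleQubitLayer L₁).mulVec (ket fun _ => false) +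
        (singleQubitLayer L₁).mulVec (ket (onesState n a))) := by
    ext z
    rw [withAncilla_inl, parityUnitary_mulVec, hφ, Pi.smul_apply, Pi.add_apply,
      singleQubitLayer_mulVec_ket, singleQubitLayer_mulVec_ket]
    simp only [Fintype.prod_sum_type, hL₁, onesState, Sum.elim_inl, Sum.elim_inr,
      OneMemClass.coe_one,
      Matrix.one_apply, gateH_apply, Bool.and_false, Bool.and_true, Bool.false_eq_true, if_false,
      one_mul, Finset.prod_mul_distrib, prod_sign_eq_parityBit,
      Finset.prod_const, Finset.card_univ, Fintype.card_fin, Finset.prod_ite_zero,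
      one_pow, Finset.mem_univ, true_imp_iff, funext_iff]
    simp only [← hr, Finset.univ_unique, Finset.prod_singleton, smul_eq_mul]
    by_cases hz : ∀ i, z (Sum.inr i) = false
    · rw [if_pos hz, if_pos hz]
      cases h1 : z (Sum.inl (Sum.inr ())) <;>
        cases h3 : parityBit (fun i => z (Sum.inl (Sum.inl i))) <;>
        simp <;> linear_combination (-2 * r ^ n) * hrr
    · rw [if_neg hz, if_neg hz]; simp
  have hφs : IsPureState φ := by
    have e1 : φ = (singleQubitLayer (Sum.elim (fun _ : Fin n => gateH) fun _ : Unit => 1)).mulVec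
        (ket fun _ => false) := by
      ext z
      rw [singleQubitLayer_mulVec_ket, hφ]
      simp only [Fintype.prod_sum_type, Sum.elim_inl, Sum.elim_inr, OneMemClass.coe_one,
        Matrix.one_apply, gateH_apply, Bool.and_false, Bool.false_eq_true, if_false, one_mul,
        Finset.prod_const, Finset.card_univ, Fintype.card_fin]
      simp [hr]
    rw [e1]
    exact (Realizes.single (P := fun _ => True) _).isPureState_mulVec _
  set χ := C.toMatrix.mulVec (withAncilla Function.Embedding.inl φ) with hχ
  set A := (singleQubitLayer L₁).conjTranspose * (C.toMatrix * singleQubitLayer L₂) with hA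
  have hAr : Realizes (fun _ => True) C.depth A := by
    have := (Realizes.single (P := fun _ => True) L₁).conjTranspose.mul
      (C.realizes.mul (Realizes.single L₂))
    simpa using this
  have hAe : ∀ g, A g (fun _ => false) =
      star (star χ ⬝ᵥ (singleQubitLayer L₁).mulVec (ket g)) := by
    intro g
    refine (mulVec_ket A (fun _ => false) g).symm.trans ?_
    rw [hA, ← Matrix.mulVec_mulVec, ← Matrix.mulVec_mulVec, hin, ← hχ]
    rw [dotProduct, star_sum]
    refine Finset.sum_congr rfl fun y _ => ?_
    rw [mulVec_ket, Pi.star_apply, star_mul', star_star, mul_comm]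
    rfl
  have hle : ∀ g, ‖A g fun _ => false‖ ≤ 1 := by
    intro g
    have h1 : ∑ z, ‖A.mulVec (ket fun _ => false) z‖ ^ 2 = 1 := hAr.isPureState_mulVec _
    have h3 := Finset.single_le_sum (f := fun z => ‖A.mulVec (ket fun _ => false) z‖ ^ 2)
      (fun z _ => by positivity) (Finset.mem_univ g)
    rw [h1] at h3
    simp only [mulVec_ket] at h3
    exact (sq_le_one_iff₀ (norm_nonneg _)).1 h3
  have hfid := hC φ hφs
  rw [pureFidelity, ← hχ, hout, dotProduct_smul, dotProduct_add, smul_eq_mul, norm_mul, mul_pow,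
    hrn, ← norm_star, star_add, ← hAe, ← hAe] at hfid
  have hsum : √(2 * p) ≤ ‖A (fun _ => false) fun _ => false‖ +
      ‖A (onesState n a) fun _ => false‖ := by
    refine Real.sqrt_le_iff.2 ⟨by positivity, ?_⟩
    calc 2 * p ≤ ‖A (fun _ => false) (fun _ => false) + A (onesState n a) fun _ => false‖ ^ 2 := by
          linarith
      _ ≤ _ := by gcongr; exact norm_add_le _ _
  refine ⟨A, hAr, ?_, ?_⟩
  · linarith [hle (onesState n a)]
  · linarith [hle fun _ => false]

end Approx

/-! ### Exact parity from an exact superposition -/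

/-- The parity of a family of bits. -/
def parityOf {J : Type} [Fintype J] (x : J → Bool) : Bool :=
  decide (Odd (Finset.univ.filter fun j => x j = true).card)

/-- `A` adds the parity of the qubits `inp j` to the qubit `tgt`, if all the other qubits are in
the state `|0⟩`. -/
def ComputesParity {V J : Type} [Fintype V] [DecidableEq V] [Fintype J]
    (A : Matrix (V → Bool) (V → Bool) ℂ) (inp : J → V) (tgt : V) : Prop :=
  ∀ x : V → Bool, (∀ v, (∀ j, v ≠ inp j) → v ≠ tgt → x v = false) →
    A.mulVec (ket x) =
      ket (Function.update x tgt (xor (x tgt) (parityOf fun j => x (inp j))))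

section Parity

variable {V V' : Type} [Fintype V] [DecidableEq V] [Fintype V'] [DecidableEq V']

theorem Realizes.conjTranspose_mul_placement {P : Finset V → Prop} {d : ℕ}
    {A : Matrix (V → Bool) (V → Bool) ℂ} (hA : Realizes P d A) (e : V ↪ V') (ρ : V' → Bool) :
    (extendUnitary e A).conjTranspose * placement e ρ = placement e ρ * A.conjTranspose := by
  have h1 : (extendUnitary e A).conjTranspose * extendUnitary e A = 1 :=
    (hA.extend (Q := fun _ => True) e fun _ _ => trivial).conjTranspose_mul_self
  have h2 : A * A.conjTranspose = 1 := mul_eq_one_comm.1 hA.conjTranspose_mul_self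
  calc (extendUnitary e A).conjTranspose * placement e ρ
      = (extendUnitary e A).conjTranspose * (placement e ρ * A) * A.conjTranspose := by
        rw [Matrix.mul_assoc, Matrix.mul_assoc, h2, Matrix.mul_one]
    _ = placement e ρ * A.conjTranspose := by
        rw [← extendUnitary_mul_placement, ← Matrix.mul_assoc, h1, Matrix.one_mul]

/-- Prepare the superposition, apply CZ between the places `c i` and the inputs, and unprepare. The
register returns to |0⟩ for even parity and becomes orthogonal to |0⟩ for odd parity. A phase
conditioned on |0⟩ and on the target, followed by undoing everything, thus leaves only a clean sign.
-/
theorem exists_parity_of_superposition {n d : ℕ} {A : Matrix (V → Bool) (V → Bool) ℂ}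
    (hA : Realizes (fun _ => True) d A) {α : ℂ} {g : V → Bool}
    (hAv : A.mulVec (ket fun _ => false) = α • (ket (fun _ => false) + ket g))
    (c : Fin n ↪ V) (hc : ∀ i, g (c i) = true) :
    ∃ B : Matrix (V ⊕ (Fin n ⊕ Unit) → Bool) (V ⊕ (Fin n ⊕ Unit) → Bool) ℂ,
      Realizes (fun _ => True) (4 * d + 3) B ∧
        ComputesParity B (fun i => Sum.inr (Sum.inl i)) (Sum.inr (Sum.inr ())) := by
  classical
  set e : V ↪ V ⊕ (Fin n ⊕ Unit) := Function.Embedding.inl with he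
  set b : V ⊕ (Fin n ⊕ Unit) := Sum.inr (Sum.inr ()) with hb
  set M : CZLayer (V ⊕ (Fin n ⊕ Unit)) := CZLayer.ofFamily (fun i : Fin n => {Sum.inl (c i), Sum.inr (Sum.inl i)})
    (fun i => by simp) (fun i j hij => by simp [Ne.symm hij]) with hM
  set F := extendUnitary e A with hF
  have hFr : Realizes (fun _ => True) d F := hA.extend e fun _ _ => trivial
  set W := F.conjTranspose * (M.toMatrix * F) with hW
  have hWr : Realizes (fun _ => True) (2 * d + 1) W := by
    have := hFr.conjTranspose.mul ((Realizes.cz M fun _ _ => trivial).mul hFr)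
    convert this using 1
    ring
  set S : Finset (V ⊕ (Fin n ⊕ Unit)) := insert b (Finset.univ.map e) with hS
  set D : Matrix (V ⊕ (Fin n ⊕ Unit) → Bool) (V ⊕ (Fin n ⊕ Unit) → Bool) ℂ := Matrix.diagonal fun x =>
    if ∀ v ∈ S, x v = (if v = b then true else false) then (-1 : ℂ) else 1 with hD
  have hDr : Realizes (fun _ => True) 1 D := realizes_phase S ⟨b, by simp [hS]⟩ trivial _
  set K := W.conjTranspose * (D * W) with hK
  have hKr : Realizes (fun _ => True) (4 * d + 3) K := by
    have := hWr.conjTranspose.mul (hDr.mul hWr)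
    convert this using 1
    ring
  have hDv : ∀ φ w, D.mulVec φ w =
      if w b = true ∧ (fun v => w (Sum.inl v)) = (fun _ => false) then -φ w else φ w := by
    intro φ w
    rw [hD, Matrix.mulVec_diagonal]
    have : (∀ v ∈ S, w v = if v = b then true else false) ↔
        w b = true ∧ (fun v => w (Sum.inl v)) = (fun _ => false) := by
      simp [hS, he, hb, funext_iff]
    rw [if_congr this rfl rfl]
    split_ifs <;> simp
  have hKv : ∀ z : V ⊕ (Fin n ⊕ Unit) → Bool, (∀ v, z (Sum.inl v) = false) → K.mulVec (ket z) =
      (if z b = true ∧ parityBit (fun i => z (Sum.inr (Sum.inl i))) = false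
        then (-1 : ℂ) else 1) • ket z := by
    intro z hz
    set E := placement e z with hE
    have hz0 : Function.extend e (fun _ => false) z = z := by
      ext v
      rcases v with v | v
      · exact (e.injective.extend_apply _ _ v).trans (hz v).symm
      · exact Function.extend_apply' _ _ _ (by simp [he])
    have hE0 : E.mulVec (ket fun _ => false) = ket z := by
      rw [hE, placement_mulVec_ket, hz0]
    set s : ℂ := if parityBit (fun i => z (Sum.inr (Sum.inl i))) then -1 else 1 with hs
    have hM0 : M.sign z = 1 := by
      rw [hM, CZLayer.sign_ofFamily]
      refine Finset.prod_eq_one fun i _ => if_neg fun h => ?_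
      simpa [hz] using h (Sum.inl (c i)) (by simp)
    have hMg : M.sign (Function.extend e g z) = s := by
      rw [hM, CZLayer.sign_ofFamily, hs, ← prod_sign_eq_parityBit]
      refine Finset.prod_congr rfl fun i _ => ?_
      have h1 : Function.extend e g z (Sum.inl (c i)) = true :=
        (e.injective.extend_apply _ _ (c i)).trans (hc i)
      have h2 : Function.extend e g z (Sum.inr (Sum.inl i)) = z (Sum.inr (Sum.inl i)) :=
        Function.extend_apply' _ _ _ (by simp [he])
      simp [h1, h2]
    set χ := α • A.conjTranspose.mulVec (ket (fun _ => false) + s • ket g) with hχ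
    have hWz : W.mulVec (ket z) = E.mulVec χ := by
      have h1 : F.mulVec (ket z) = α • (ket z + ket (Function.extend e g z)) := by
        rw [← hE0, Matrix.mulVec_mulVec, hF, hE, extendUnitary_mul_placement,
          ← Matrix.mulVec_mulVec, hAv, Matrix.mulVec_smul, Matrix.mulVec_add,
          placement_mulVec_ket, placement_mulVec_ket, hz0]
      have h2 : ∀ φ, F.conjTranspose.mulVec (E.mulVec φ) =
          E.mulVec (A.conjTranspose.mulVec φ) := fun φ => by
        rw [Matrix.mulVec_mulVec, hF, hE, hA.conjTranspose_mul_placement, Matrix.mulVec_mulVec]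
      have h3 : ket z + s • ket (Function.extend e g z) =
          E.mulVec (ket (fun _ => false) + s • ket g) := by
        rw [Matrix.mulVec_add, Matrix.mulVec_smul, hE0, hE, placement_mulVec_ket]
      rw [hW, ← Matrix.mulVec_mulVec, ← Matrix.mulVec_mulVec, h1, Matrix.mulVec_smul,
        Matrix.mulVec_add, M.toMatrix_eq, diagonal_mulVec_ket, diagonal_mulVec_ket, hM0, hMg,
        one_smul, h3, Matrix.mulVec_smul, h2, hχ, Matrix.mulVec_smul]
    have hDW : D.mulVec (W.mulVec (ket z)) =
        (if z b = true ∧ parityBit (fun i => z (Sum.inr (Sum.inl i))) = false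
          then (-1 : ℂ) else 1) • W.mulVec (ket z) := by
      -- Even parity: χ is |0⟩ itself. Odd parity: |0⟩ - |g⟩ is orthogonal to A|0⟩, so χ has no
      -- amplitude at |0⟩ and `D` acts trivially.
      cases hp : parityBit (fun i => z (Sum.inr (Sum.inl i)))
      · have hχ0 : χ = ket fun _ => false := by
          rw [hχ, hs, hp, if_neg (by simp), one_smul, ← Matrix.mulVec_smul, ← hAv,
            hA.mulVec_conjTranspose_mulVec]
        rw [hWz, hχ0, hE0]
        ext w
        rw [hDv, Pi.smul_apply, ket_apply]
        by_cases hw : w = z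
        · subst hw
          simp only [hz, and_true]
          split_ifs <;> simp
        · simp [hw]
      · have hχ0 : χ (fun _ => false) = 0 := by
          have h1 : χ (fun _ => false) = α * (star (A.mulVec (ket fun _ => false)) ⬝ᵥ
              (ket (fun _ => false) + s • ket g)) := by
            rw [hχ, Pi.smul_apply, Matrix.star_mulVec, ← Matrix.dotProduct_mulVec,
              star_ket_dotProduct, smul_eq_mul]
          rw [h1, hAv, hs, hp, if_pos rfl, star_smul, smul_dotProduct, star_add, add_dotProduct,
            star_ket_dotProduct, star_ket_dotProduct]
          by_cases hg : g = fun _ => false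
          · simp [hg]
          · simp [ket_apply, hg, Ne.symm hg]
        rw [hWz]
        ext w
        rw [hDv]
        simp only [Bool.true_eq_false, and_false, if_false, one_smul]
        split_ifs with hw
        · rw [hE, placement_mulVec_apply]
          split_ifs
          · have : (fun v => w (e v)) = fun _ => false := hw.2
            rw [this, hχ0, neg_zero]
          · simp
        · rfl
    rw [hK, ← Matrix.mulVec_mulVec, ← Matrix.mulVec_mulVec, hDW, Matrix.mulVec_smul,
      hWr.mulVec_conjTranspose_mulVec]
  -- `K` is a Z on the target when the parity is even. Hadamard conjugation makes it an X, and the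
  -- extra X switches the flip to the odd case.
  refine ⟨singleQubitLayer (fun v => if v = b then gateX * gateH else 1) *
    (K * singleQubitLayer fun v => if v = b then gateH else 1), ?_, fun x hx => ?_⟩
  · simpa using (Realizes.single (P := fun _ => True) _).mul (hKr.mul (Realizes.single _))
  set par := parityOf (fun i => x (Sum.inr (Sum.inl i))) with hpar
  refine conj_singleQubitLayer_mulVec_ket
    (Z := fun v => if (decide (v = b) && !par) = true then gateZ else 1) ?_ ?_
  · intro z hz
    have hzx : ∀ v, v ≠ b → z v = x v := by
      intro v hv
      by_contra hne
      exact hz v (by simp [hv, hne])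
    have hz0 : ∀ v, z (Sum.inl v) = false := fun v => by
      rw [hzx _ (by simp [hb]), hx _ (by simp) (by simp)]
    have hpz : parityBit (fun i => z (Sum.inr (Sum.inl i))) = par := by
      rw [hpar, funext fun i => hzx (Sum.inr (Sum.inl i)) (by simp [hb])]
      rfl
    rw [hKv z hz0, hpz, signLayer_mulVec_ket]
    congr 1
    rw [Finset.prod_eq_single b (fun v _ hv => by simp [hv]) (by simp)]
    refine if_congr ?_ rfl rfl
    simp [and_comm]
  · intro v b'
    have e1 : (gateH : Matrix Bool Bool ℂ) * gateH = 1 := congrArg Subtype.val gateH_mul_self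
    have e2 : (gateH : Matrix Bool Bool ℂ) * (gateZ * gateH) = gateX :=
      congrArg Subtype.val gateH_mul_gateZ_mul_gateH
    have e3 : (gateX : Matrix Bool Bool ℂ) * gateX = 1 := congrArg Subtype.val gateX_mul_self
    by_cases hv : v = b
    · subst hv
      rw [Function.update_self]
      cases hp : par
      · simp [Matrix.mul_assoc, e2, e3, Matrix.one_apply]
      · simp [Matrix.mul_assoc, e1, gateX_apply]
    · rw [Function.update_of_ne hv]
      simp [hv, Matrix.one_apply]

end Parity

/-- The register of the exact parity circuit: a register for the given circuit, two qubits used for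
the amplification, and the input and target qubits. -/
abbrev ParityRegister (n a : ℕ) : Type := (((Fin n ⊕ Unit) ⊕ Fin a) ⊕ Bool) ⊕ (Fin n ⊕ Unit)

theorem exists_exact_parity {p : ℝ} (hp : 1 / 2 < p) (C : QAC0Family)
    (hC : ∀ n : ℕ, SolvesApproxClean p (C.circuit n) Function.Embedding.inl (parityUnitary n)) :
    ∃ d, ∀ n, ∃ B : Matrix (ParityRegister n (C.ancillas n) → Bool)
        (ParityRegister n (C.ancillas n) → Bool) ℂ,
      Realizes (fun _ => True) d B ∧
        ComputesParity B (fun i => Sum.inr (Sum.inl i)) (Sum.inr (Sum.inr ())) := by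
  obtain ⟨d, hd⟩ := C.const_depth
  have hδ : 0 < √(2 * p) - 1 := by
    have : 1 < √(2 * p) := Real.lt_sqrt_of_sq_lt (by linarith)
    linarith
  obtain ⟨j, hj, hjδ⟩ := exists_grover_angle_le hδ
  refine ⟨4 * (j * (2 * d + 3) + d) + 3, fun n => ?_⟩
  obtain ⟨A, hA, h₀, h₁⟩ := exists_cat_amplitudes (C.circuit n) (hC n)
  obtain ⟨B, α, b, hB, hBv⟩ := exists_superposition hj (hA.mono (hd n)) hδ hjδ h₀ h₁
  exact exists_parity_of_superposition hB hBv
    (((Function.Embedding.inl : Fin n ↪ Fin n ⊕ Unit).trans Function.Embedding.inl).trans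
      Function.Embedding.inl) fun i => rfl

/-! ### Simulation on a lattice -/

section Lattice

variable {V : Type} [Fintype V] [DecidableEq V] {N : ℕ}

/-- The placement of a register in the first column of a lattice. -/
def firstColumn (σ : V ≃ Fin N) : V ↪ Fin N × Fin (N + 1) :=
  ⟨fun v => (σ v, 0), fun _ _ h => σ.injective (congrArg Prod.fst h)⟩

theorem isLineInterval_row {w l : ℕ} (i : Fin w) (a b : Fin l) :
    IsLineInterval ({i} ×ˢ Finset.Icc a b) :=
  Or.inl ⟨i, a, b, rfl⟩

theorem isLineInterval_column {w l : ℕ} (a b : Fin w) (j : Fin l) :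
    IsLineInterval (Finset.Icc a b ×ˢ {j}) :=
  Or.inr ⟨a, b, j, rfl⟩

theorem isLineInterval_full_column {w l : ℕ} (r : Fin w) (j : Fin l) :
    IsLineInterval ((Finset.univ : Finset (Fin w)) ×ˢ {j}) := by
  obtain _ | w := w
  · exact r.elim0
  · exact Or.inr ⟨⊥, ⊤, j, by rw [Finset.Icc_bot_top]⟩

/-- Each gate gets a private column. The bits of its support are copied there along their rows, the
gate acts vertically, and the copying is undone: three layers. -/
theorem exists_lattice_czLayer (σ : V ≃ Fin N) (M : CZLayer V) :
    ∃ W : Matrix (Fin N × Fin (N + 1) → Bool) (Fin N × Fin (N + 1) → Bool) ℂ, Realizes IsLineInterval 3 W ∧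
      W * placement (firstColumn σ) (fun _ => false) =
        placement (firstColumn σ) (fun _ => false) * M.toMatrix := by
  classical
  set e := firstColumn σ with he
  have hext : ∀ (y : V → Bool) v, Function.extend e y (fun _ => false) (σ v, 0) = y v :=
    fun y v => e.injective.extend_apply y _ v
  have hext' : ∀ (y : V → Bool) r c, c ≠ 0 →
      Function.extend e y (fun _ => false) (r, c) = false := fun y r c hc =>
    Function.extend_apply' _ _ _ (by rintro ⟨v, hv⟩; exact hc (congrArg Prod.snd hv).symm)
  -- The row number of a chosen element, shifted by one past the data column. Disjoint supports have
  -- different chosen elements, so their columns differ; the value 0 for the empty set is never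
  -- used.
  set col : Finset V → Fin (N + 1) := fun S =>
    if h : S.Nonempty then (σ h.choose).succ else 0 with hcol
  have hcol0 : ∀ S ∈ M.supports, col S ≠ 0 := by
    intro S hS
    simp only [hcol, dif_pos (M.nonempty S hS)]
    exact Fin.succ_ne_zero _
  have hcolinj : ∀ S ∈ M.supports, ∀ T ∈ M.supports, col S = col T → S = T := by
    intro S hS T hT h
    simp only [hcol, dif_pos (M.nonempty S hS), dif_pos (M.nonempty T hT), Fin.succ_inj,
      σ.injective.eq_iff] at h
    exact M.disjoint.elim_finset hS hT _ (M.nonempty S hS).choose_spec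
      (h ▸ (M.nonempty T hT).choose_spec)
  let I := {v : V // ∃ S ∈ M.supports, v ∈ S}
  choose supp hsupp hmem using fun i : I => i.2
  have hsupp_eq : ∀ (i : I), ∀ S ∈ M.supports, i.1 ∈ S → supp i = S := fun i S hS hi =>
    M.disjoint.elim_finset (hsupp i) hS _ (hmem i) hi
  obtain ⟨Cp, hCp, hCpv⟩ := exists_copy (P := IsLineInterval)
    (fun i : I => ({σ i.1} : Finset (Fin N)) ×ˢ Finset.Icc 0 (col (supp i)))
    (fun i => (σ i.1, 0)) (fun i => (σ i.1, col (supp i)))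
    (fun i => by simp) (fun i => by simp)
    (fun i h => hcol0 _ (hsupp i) (congrArg Prod.snd h).symm)
    (fun i j hij => by
      rw [Finset.disjoint_product]
      left
      simpa [Subtype.ext_iff] using fun h => hij (Subtype.ext h))
    (fun i => isLineInterval_row _ _ _)
  let I' := {S : Finset V // S ∈ M.supports}
  set M' : CZLayer (Fin N × Fin (N + 1)) :=
    CZLayer.ofFamily (fun S : I' => (Finset.univ : Finset (Fin N)) ×ˢ {col S.1})
      (fun S => by
        obtain ⟨v, -⟩ := M.nonempty _ S.2
        exact ⟨(σ v, col S.1), by simp⟩)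
      (fun S T hST => by
        rw [Finset.disjoint_product]
        right
        simpa using fun h => hST (Subtype.ext (hcolinj _ S.2 _ T.2 h))) with hM'
  -- A support need not be contiguous, so the gate spans the whole column. Rows outside the support
  -- hold 0 there and meet the pattern automatically.
  set pat : Fin N × Fin (N + 1) → Bool := fun v =>
    decide (∃ S ∈ M.supports, v.2 = col S ∧ σ.symm v.1 ∈ S) with hpat
  have hph := realizes_patterned (P := IsLineInterval) M' (by
    intro S hS
    simp only [hM', CZLayer.ofFamily, Finset.mem_image, Finset.mem_univ, true_and] at hS
    obtain ⟨T, rfl⟩ := hS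
    obtain ⟨v, -⟩ := M.nonempty _ T.2
    exact isLineInterval_full_column (σ v) _) pat
  refine ⟨Cp.conjTranspose * (_ * Cp), hCp.conjTranspose.mul (hph.mul hCp),
    matrix_ext_ket fun y => ?_⟩
  rw [← Matrix.mulVec_mulVec, ← Matrix.mulVec_mulVec, ← Matrix.mulVec_mulVec,
    ← Matrix.mulVec_mulVec, placement_mulVec_ket, M.toMatrix_eq, diagonal_mulVec_ket,
    Matrix.mulVec_smul, placement_mulVec_ket]
  have hx : Cp.mulVec (ket (Function.extend e y fun _ => false)) = _ := hCpv _ (by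
    rintro i ⟨r, c⟩ hv hs _
    simp only [Finset.mem_product, Finset.mem_singleton] at hv
    refine hext' y r c fun h => hs ?_
    rw [h, hv.1])
  rw [hx, diagonal_mulVec_ket, Matrix.mulVec_smul, ← hx, hCp.mulVec_conjTranspose_mulVec]
  congr 1
  rw [hM', CZLayer.sign_ofFamily, CZLayer.sign, ← Finset.prod_coe_sort M.supports
    fun S => if ∀ v ∈ S, y v = true then (-1 : ℂ) else 1]
  refine Finset.prod_congr rfl fun S _ => if_congr ?_ rfl rfl
  have key : ∀ v, (∃ i : I, ((σ v, col S.1) : Fin N × Fin (N + 1)) = (σ i.1, col (supp i)) ∧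
      Function.extend e y (fun _ => false) (σ i.1, 0) = true) ↔ v ∈ S.1 ∧ y v = true := by
    intro v
    constructor
    · rintro ⟨i, hi, hy⟩
      rw [Prod.mk.injEq, σ.injective.eq_iff] at hi
      obtain ⟨rfl, hi⟩ := hi
      rw [hext] at hy
      rw [hcolinj _ S.2 _ (hsupp i) hi]
      exact ⟨hmem i, hy⟩
    · rintro ⟨hv, hy⟩
      refine ⟨⟨v, S.1, S.2, hv⟩, ?_, ?_⟩
      · rw [hsupp_eq _ S.1 S.2 hv]
      · rw [hext, hy]
  have hp : ∀ v, pat (σ v, col S.1) = true ↔ v ∈ S.1 := by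
    intro v
    simp only [hpat, decide_eq_true_eq, Equiv.symm_apply_apply]
    constructor
    · rintro ⟨T, hT, hc, hv⟩
      rwa [hcolinj _ S.2 _ hT hc]
    · exact fun hv => ⟨S.1, S.2, rfl, hv⟩
  constructor
  · intro h v hv
    have h1 := h (σ v, col S.1) (by simp)
    beta_reduce at h1
    rw [hext' y _ _ (hcol0 _ S.2), (hp v).2 hv] at h1
    simp only [Bool.false_xor, beq_true, decide_eq_true_eq] at h1
    exact ((key v).1 h1).2
  · rintro h ⟨r, c⟩ hv
    obtain rfl : c = col S.1 := by simpa [eq_comm] using hv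
    obtain ⟨v, rfl⟩ := σ.surjective r
    beta_reduce
    rw [hext' y _ _ (hcol0 _ S.2), Bool.false_xor, beq_iff_eq, Bool.eq_iff_iff, hp,
      decide_eq_true_eq, key]
    exact ⟨fun h' => h'.1, fun h' => ⟨h', h v h'⟩⟩

/-- A circuit on `N` qubits is simulated on an `N × (N + 1)` lattice, the data being kept in the
first column. -/
theorem exists_lattice_simulation (σ : V ≃ Fin N) {P : Finset V → Prop} {d : ℕ}
    {A : Matrix (V → Bool) (V → Bool) ℂ} (hA : Realizes P d A) :
    ∃ W : Matrix (Fin N × Fin (N + 1) → Bool) (Fin N × Fin (N + 1) → Bool) ℂ, Realizes IsLineInterval (3 * d) W ∧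
      W * placement (firstColumn σ) (fun _ => false) =
        placement (firstColumn σ) (fun _ => false) * A := by
  induction hA with
  | single L =>
    refine ⟨extendUnitary (firstColumn σ) (singleQubitLayer L), ?_,
      extendUnitary_mul_placement _ _ _⟩
    rw [extendUnitary, parallel_singleQubitLayer]
    exact .single _
  | cz M _ => exact exists_lattice_czLayer σ M
  | mul _ _ h₁ h₂ =>
    obtain ⟨W₁, hW₁, h₁⟩ := h₁
    obtain ⟨W₂, hW₂, h₂⟩ := h₂
    refine ⟨W₁ * W₂, ?_, ?_⟩
    · rw [mul_add]; exact hW₁.mul hW₂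
    · rw [Matrix.mul_assoc, h₂, ← Matrix.mul_assoc, h₁, Matrix.mul_assoc]

end Lattice

theorem ComputesParity.of_placement {V V' J : Type} [Fintype V] [DecidableEq V] [Fintype V']
    [DecidableEq V'] [Fintype J] {A : Matrix (V → Bool) (V → Bool) ℂ}
    {W : Matrix (V' → Bool) (V' → Bool) ℂ} (e : V ↪ V')
    (hW : W * placement e (fun _ => false) = placement e (fun _ => false) * A)
    {inp : J → V} {tgt : V} (hA : ComputesParity A inp tgt) :
    ComputesParity W (fun j => e (inp j)) (e tgt) := by
  intro x hx
  have hoff : ∀ v, v ∉ Set.range e → x v = false := fun v hv =>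
    hx v (fun j h => hv ⟨_, h.symm⟩) fun h => hv ⟨_, h.symm⟩
  have hext : ∀ y : V → Bool, (∀ v, v ∉ Set.range e → x v = false) →
      ∀ z : V' → Bool, (∀ v, z (e v) = y v) → (∀ v, v ∉ Set.range e → z v = false) →
      Function.extend e y (fun _ => false) = z := by
    intro y _ z hz hz'
    ext v
    by_cases hv : v ∈ Set.range e
    · obtain ⟨u, rfl⟩ := hv
      rw [e.injective.extend_apply, hz]
    · rw [Function.extend_apply' _ _ _ (by simpa using hv), hz' v hv]
  have h1 := hext (fun v => x (e v)) hoff x (fun _ => rfl) hoff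
  conv_lhs => rw [← h1]
  rw [← placement_mulVec_ket, Matrix.mulVec_mulVec, hW, ← Matrix.mulVec_mulVec,
    hA _ fun v hv hvt => hx _ (fun j h => hv j (e.injective h)) fun h => hvt (e.injective h),
    placement_mulVec_ket]
  congr 1
  refine hext _ hoff _ (fun v => ?_) fun v hv => ?_
  · by_cases h : v = tgt
    · subst h; simp
    · rw [Function.update_of_ne h, Function.update_of_ne (fun h' => h (e.injective h'))]
  · rw [Function.update_of_ne (fun h => hv ⟨tgt, h.symm⟩), hoff v hv]

/-! ### Composition of parity circuits -/

theorem extendUnitary_mulVec_ket {V V' : Type} [Fintype V] [DecidableEq V] [Fintype V']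
    [DecidableEq V'] (e : V ↪ V') {A : Matrix (V → Bool) (V → Bool) ℂ} {x y : V' → Bool}
    (hA : A.mulVec (ket fun v => x (e v)) = ket fun v => y (e v))
    (hxy : ∀ v, v ∉ Set.range e → x v = y v) : (extendUnitary e A).mulVec (ket x) = ket y := by
  refine parallel_mulVec_ket _ (fun _ => hA) fun v hv => hxy v ?_
  rintro ⟨u, rfl⟩
  exact hv ⟨((), u), rfl⟩

theorem parityOf_prod {I J : Type} [Fintype I] [Fintype J] (x : I × J → Bool) :
    parityOf x = parityOf fun i => parityOf fun j => x (i, j) := by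
  have h : ∀ {K : Type} [Fintype K] (y : K → Bool),
      parityOf y = true ↔ Odd (∑ k, (y k).toNat) := by
    intro K _ y
    rw [parityOf, decide_eq_true_eq, Finset.odd_sum_iff_odd_card_odd]
    refine iff_of_eq (congrArg Odd (congrArg Finset.card (Finset.filter_congr fun k _ => ?_)))
    cases y k <;> simp
  have h' : ∀ {K : Type} [Fintype K] (y : K → Bool), (parityOf y).toNat % 2 =
      (∑ k, (y k).toNat) % 2 := by
    intro K _ y
    cases hp : parityOf y
    · have : ¬ Odd (∑ k, (y k).toNat) := fun hc => by simp [(h y).2 hc] at hp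
      rw [Nat.not_odd_iff.1 this]
      rfl
    · rw [Nat.odd_iff.1 ((h y).1 hp)]
      rfl
  rw [Bool.eq_iff_iff, h, h, Nat.odd_iff, Nat.odd_iff, Fintype.sum_prod_type, Finset.sum_nat_mod]
  simp only [fun i => (h' fun j => x (i, j)).symm]
  rw [← Finset.sum_nat_mod]

/-- The basis state `x` with the bits `b i` added at the places `f i`. -/
noncomputable def addBits {V I : Type} (x : V → Bool) (f : I → V) (b : I → Bool) : V → Bool :=
  fun v => xor (x v) (open Classical in decide (∃ i, v = f i ∧ b i = true))

theorem addBits_apply {V I : Type} (x : V → Bool) {f : I → V} (hf : Function.Injective f)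
    (b : I → Bool) (i : I) : addBits x f b (f i) = xor (x (f i)) (b i) := by
  have : (∃ j, f i = f j ∧ b j = true) ↔ b i = true := by
    constructor
    · rintro ⟨j, hj, hb⟩
      rwa [hf hj]
    · exact fun h => ⟨i, rfl, h⟩
  simp only [addBits, this, Bool.decide_eq_true]

theorem addBits_of_ne {V I : Type} (x : V → Bool) {f : I → V} (b : I → Bool) {v : V}
    (hv : ∀ i, v ≠ f i) : addBits x f b v = x v := by
  have : ¬ ∃ j, v = f j ∧ b j = true := fun ⟨j, hj, _⟩ => hv j hj
  simp only [addBits, this, decide_false, Bool.xor_false]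

theorem addBits_update {V I : Type} [DecidableEq V] (x : V → Bool) {f : I → V} (b : I → Bool)
    {t : V} (ht : ∀ i, t ≠ f i) (c : Bool) :
    addBits (Function.update x t c) f b = Function.update (addBits x f b) t c := by
  ext v
  by_cases h : v = t
  · subst h
    rw [addBits_of_ne _ _ ht, Function.update_self, Function.update_self]
  · rw [Function.update_of_ne h, addBits, addBits, Function.update_of_ne h]

/-- All blocks compute their parities in parallel, each result is copied to a corner `Q i` and on to
an input of the central circuit, that circuit adds up the block parities, and the routing is undone.
Two hops are needed because each must follow a line. The side conditions ensure that inner qubits of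
a segment hold 0 when it is used: `S₁ i` may cross block ancillas but no inputs, and `S₂ i` avoids
the blocks. -/
theorem exists_composed_parity {V Vb V₀ I J : Type} [Fintype V] [DecidableEq V] [Fintype Vb]
    [DecidableEq Vb] [Fintype V₀] [DecidableEq V₀] [Fintype I] [Fintype J]
    {P : Finset V → Prop} {Pb : Finset Vb → Prop} {P₀ : Finset V₀ → Prop}
    (e : I × Vb ↪ V) (e₀ : V₀ ↪ V) (hdisj : ∀ p v, e p ≠ e₀ v)
    (hPb : ∀ i S, Pb S → P (S.map ((Function.Embedding.sectR i Vb).trans e)))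
    (hP₀ : ∀ S, P₀ S → P (S.map e₀))
    {d d₀ : ℕ} {A : Matrix (Vb → Bool) (Vb → Bool) ℂ} (hA : Realizes Pb d A)
    {inp : J → Vb} {tgt : Vb} (hinp : ∀ j, inp j ≠ tgt) (hAp : ComputesParity A inp tgt)
    {B : Matrix (V₀ → Bool) (V₀ → Bool) ℂ} (hB : Realizes P₀ d₀ B)
    {inp₀ : I → V₀} {tgt₀ : V₀} (hinp₀ : ∀ i, inp₀ i ≠ tgt₀) (hBp : ComputesParity B inp₀ tgt₀)
    (Q : I → V) (hQ : ∀ i v, Q i ≠ e₀ v) (hQe : ∀ i p, Q i ≠ e p)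
    (S₁ S₂ : I → Finset V) (hS₁ : ∀ i, P (S₁ i)) (hS₂ : ∀ i, P (S₂ i))
    (hd₁ : ∀ i j, i ≠ j → Disjoint (S₁ i) (S₁ j)) (hd₂ : ∀ i j, i ≠ j → Disjoint (S₂ i) (S₂ j))
    (hT₁ : ∀ i, e (i, tgt) ∈ S₁ i) (hQ₁ : ∀ i, Q i ∈ S₁ i)
    (hQ₂ : ∀ i, Q i ∈ S₂ i) (hR₂ : ∀ i, e₀ (inp₀ i) ∈ S₂ i)
    (htgt₁ : ∀ i, e₀ tgt₀ ∉ S₁ i) (htgt₂ : ∀ i, e₀ tgt₀ ∉ S₂ i)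
    (hinp₁ : ∀ i k j, e (k, inp j) ∉ S₁ i) (hinp₂ : ∀ i p, e p ∉ S₂ i) :
    ∃ K, Realizes P (2 * (d + 2) + d₀) K ∧
      ComputesParity K (fun p : I × J => e (p.1, inp p.2)) (e₀ tgt₀) := by
  classical
  set T : I → V := fun i => e (i, tgt) with hT
  set R : I → V := fun i => e₀ (inp₀ i) with hR
  have hinj : ∀ {S : I → Finset V} {f : I → V}, (∀ i j, i ≠ j → Disjoint (S i) (S j)) →
      (∀ i, f i ∈ S i) → Function.Injective f := fun hd hf i j h => by_contra fun hne =>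
    Finset.disjoint_left.1 (hd i j hne) (hf i) (h ▸ hf j)
  have hTinj : Function.Injective T := hinj hd₁ hT₁
  have hQinj : Function.Injective Q := hinj hd₁ hQ₁
  have hRinj : Function.Injective R := hinj hd₂ hR₂
  obtain ⟨C₁, hC₁, hC₁v⟩ := exists_copy S₁ T Q hT₁ hQ₁ (fun i h => hQe i _ h.symm) hd₁ hS₁
  obtain ⟨C₂, hC₂, hC₂v⟩ := exists_copy S₂ Q R hQ₂ hR₂ (fun i => hQ i _) hd₂ hS₂
  set U := C₂ * (C₁ * parallel e A) with hU
  have hUr : Realizes P (d + 2) U := by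
    have := hC₂.mul (hC₁.mul (hA.parallel e hPb))
    convert this using 1
    ring
  let par : (V → Bool) → I → Bool := fun x i => parityOf fun j => x (e (i, inp j))
  let valid : (V → Bool) → Prop := fun x =>
    ∀ v, (∀ p : I × J, v ≠ e (p.1, inp p.2)) → v ≠ e₀ tgt₀ → x v = false
  have hxT : ∀ x, valid x → ∀ i, x (T i) = false := fun x hx i =>
    hx _ (fun p h => hinp p.2 (congrArg Prod.snd (e.injective h)).symm) (hdisj _ _)
  have hxQ : ∀ x, valid x → ∀ i, x (Q i) = false := fun x hx i =>
    hx _ (fun p => hQe i _) (hQ i _)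
  have hxR : ∀ x, valid x → ∀ i, x (R i) = false := fun x hx i =>
    hx _ (fun p h => hdisj _ _ h.symm) fun h => hinp₀ i (e₀.injective h)
  let st₁ : (V → Bool) → V → Bool := fun x => addBits x T (par x)
  let st₂ : (V → Bool) → V → Bool := fun x => addBits (st₁ x) Q (par x)
  let st₃ : (V → Bool) → V → Bool := fun x => addBits (st₂ x) R (par x)
  have h₁T : ∀ x, valid x → ∀ i, st₁ x (T i) = par x i := fun x hx i => by
    simp only [st₁]
    rw [addBits_apply _ hTinj, hxT x hx, Bool.false_xor]
  have h₂Q : ∀ x, valid x → ∀ i, st₂ x (Q i) = par x i := fun x hx i => by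
    simp only [st₂, st₁]
    rw [addBits_apply _ hQinj, addBits_of_ne _ _ fun k => hQe i _, hxQ x hx, Bool.false_xor]
  have hUv : ∀ x, valid x → U.mulVec (ket x) = ket (st₃ x) := by
    intro x hx
    have e1 : (parallel e A).mulVec (ket x) = ket (st₁ x) := by
      refine parallel_mulVec_ket e (fun i => ?_) fun v hv => ?_
      · rw [hAp]
        · congr 1
          ext v
          by_cases hv : v = tgt
          · subst hv
            rw [Function.update_self]
            exact (congrArg (xor · _) (hxT x hx i)).trans
              ((Bool.false_xor _).trans (h₁T x hx i).symm)
          · rw [Function.update_of_ne hv]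
            exact (addBits_of_ne _ _ fun k h =>
              hv (congrArg Prod.snd (e.injective h))).symm
        · intro v hv hvt
          exact hx _ (fun p h => hv p.2 (congrArg Prod.snd (e.injective h))) (hdisj _ _)
      · exact (addBits_of_ne _ _ fun k h => hv ⟨_, h.symm⟩).symm
    have e2 : C₁.mulVec (ket (st₁ x)) = ket (st₂ x) := by
      rw [hC₁v]
      · simp only [h₁T x hx]
        exact congrArg ket (funext fun v => congrArg (xor _) (decide_eq_decide.2 Iff.rfl))
      · intro i v hv hvT hvQ
        refine (addBits_of_ne _ _ fun k h => ?_).trans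
          (hx v (fun p h => hinp₁ i _ _ (h ▸ hv)) fun h => htgt₁ i (h ▸ hv))
        by_cases hik : i = k
        · exact hvT (hik ▸ h)
        · exact Finset.disjoint_left.1 (hd₁ i k hik) hv (h ▸ hT₁ k)
    have e3 : C₂.mulVec (ket (st₂ x)) = ket (st₃ x) := by
      rw [hC₂v]
      · simp only [h₂Q x hx]
        exact congrArg ket (funext fun v => congrArg (xor _) (decide_eq_decide.2 Iff.rfl))
      · intro i v hv hvQ hvR
        refine (addBits_of_ne _ _ fun k h => ?_).trans ((addBits_of_ne _ _ fun k h => ?_).trans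
          (hx v (fun p h => hinp₂ i _ (h ▸ hv)) fun h => htgt₂ i (h ▸ hv)))
        · by_cases hik : i = k
          · exact hvQ (hik ▸ h)
          · exact Finset.disjoint_left.1 (hd₂ i k hik) hv (h ▸ hQ₂ k)
        · exact hinp₂ i _ (h ▸ hv)
    rw [hU, ← Matrix.mulVec_mulVec, ← Matrix.mulVec_mulVec, e1, e2, e3]
  refine ⟨U.conjTranspose * (extendUnitary e₀ B * U), ?_, fun x hx => ?_⟩
  · have := hUr.conjTranspose.mul ((hB.extend e₀ hP₀).mul hUr)
    convert this using 1
    ring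
  set c := xor (x (e₀ tgt₀)) (parityOf fun p : I × J => x (e (p.1, inp p.2))) with hc
  have hx' : valid (Function.update x (e₀ tgt₀) c) := by
    intro v hv hvt
    rw [Function.update_of_ne hvt, hx v hv hvt]
  have hpar : par (Function.update x (e₀ tgt₀) c) = par x := by
    ext i
    simp only [par]
    congr 1
    ext j
    rw [Function.update_of_ne (hdisj _ _)]
  have htT : ∀ i, e₀ tgt₀ ≠ T i := fun i h => hdisj _ _ h.symm
  have htQ : ∀ i, e₀ tgt₀ ≠ Q i := fun i h => hQ i _ h.symm
  have htR : ∀ i, e₀ tgt₀ ≠ R i := fun i h => hinp₀ i (e₀.injective h).symm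
  -- The routing neither reads nor changes the final target, so undoing it after the target has been
  -- updated restores everything else.
  have hst : st₃ (Function.update x (e₀ tgt₀) c) = Function.update (st₃ x) (e₀ tgt₀) c := by
    simp only [st₃, st₂, st₁, hpar]
    rw [addBits_update _ _ htT, addBits_update _ _ htQ, addBits_update _ _ htR]
  have hBv : (extendUnitary e₀ B).mulVec (ket (st₃ x)) =
      ket (Function.update (st₃ x) (e₀ tgt₀) c) := by
    have h3R : ∀ i, st₃ x (e₀ (inp₀ i)) = par x i := fun i => by
      simp only [st₃, st₂, st₁]
      rw [show e₀ (inp₀ i) = R i from rfl, addBits_apply _ hRinj,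
        addBits_of_ne _ _ fun k h => hQ k _ h.symm,
        addBits_of_ne _ _ fun k h => hdisj _ _ h.symm, hxR x hx, Bool.false_xor]
    have h3t : st₃ x (e₀ tgt₀) = x (e₀ tgt₀) := by
      simp only [st₃, st₂, st₁]
      rw [addBits_of_ne _ _ htR, addBits_of_ne _ _ htQ, addBits_of_ne _ _ htT]
    refine extendUnitary_mulVec_ket e₀ ?_ fun v hv => ?_
    · rw [hBp]
      · congr 1
        ext v
        by_cases hv : v = tgt₀
        · subst hv
          rw [Function.update_self, Function.update_self, hc, parityOf_prod, h3t]
          simp only [h3R]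
          rfl
        · rw [Function.update_of_ne hv,
            Function.update_of_ne fun h => hv (e₀.injective h)]
      · intro v hv hvt
        refine (addBits_of_ne _ _ fun k h => hv k (e₀.injective h)).trans
          ((addBits_of_ne _ _ fun k h => hQ k _ h.symm).trans
          ((addBits_of_ne _ _ fun k h => hdisj _ _ h.symm).trans
          (hx _ (fun p h => hdisj _ _ h.symm) fun h => hvt (e₀.injective h))))
    · rw [Function.update_of_ne fun h => hv ⟨_, h.symm⟩]
  rw [← Matrix.mulVec_mulVec, ← Matrix.mulVec_mulVec, hUv x hx, hBv, ← hst, ← hUv _ hx',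
    hUr.mulVec_conjTranspose_mulVec]

/-! ### Lattice layout of the tree of parity circuits -/

theorem isLineInterval_map {w l w' l' : ℕ} (f : Fin w × Fin l ↪ Fin w' × Fin l') (a b : ℕ)
    (h₁ : ∀ p, (f p).1.val = p.1.val + a) (h₂ : ∀ p, (f p).2.val = p.2.val + b)
    (S : Finset (Fin w × Fin l)) (hS : IsLineInterval S) : IsLineInterval (S.map f) := by
  obtain ⟨i, p, q, rfl⟩ | ⟨p, q, j, rfl⟩ := hS
  · refine Or.inl ⟨(f (i, p)).1, (f (i, p)).2, (f (i, q)).2, ?_⟩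
    ext ⟨u, v⟩
    simp only [Finset.mem_map, Finset.mem_product, Finset.mem_singleton, Finset.mem_Icc,
      Fin.le_def, Fin.ext_iff, h₁, h₂]
    constructor
    · rintro ⟨⟨i', j⟩, ⟨hi, hp, hq⟩, hf⟩
      have e1 := h₁ (i', j)
      have e2 := h₂ (i', j)
      simp only [hf] at *
      omega
    · rintro ⟨hu, hp, hq⟩
      have hlt := q.isLt
      refine ⟨(i, ⟨v.val - b, by omega⟩), ⟨rfl, ?_, ?_⟩, ?_⟩
      · change p.val ≤ v.val - b; omega
      · change v.val - b ≤ q.val; omega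
      · refine Prod.ext (Fin.ext ?_) (Fin.ext ?_)
        · rw [h₁, hu]
        · rw [h₂]; change v.val - b + b = v.val; omega
  · refine Or.inr ⟨(f (p, j)).1, (f (q, j)).1, (f (p, j)).2, ?_⟩
    ext ⟨u, v⟩
    simp only [Finset.mem_map, Finset.mem_product, Finset.mem_singleton, Finset.mem_Icc,
      Fin.le_def, Fin.ext_iff, h₁, h₂]
    constructor
    · rintro ⟨⟨i, j'⟩, ⟨⟨hp, hq⟩, hj⟩, hf⟩
      have e1 := h₁ (i, j')
      have e2 := h₂ (i, j')
      simp only [hf] at *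
      omega
    · rintro ⟨⟨hp, hq⟩, hv⟩
      have hlt := q.isLt
      refine ⟨(⟨u.val - a, by omega⟩, j), ⟨⟨?_, ?_⟩, rfl⟩, ?_⟩
      · change p.val ≤ u.val - a; omega
      · change u.val - a ≤ q.val; omega
      · refine Prod.ext (Fin.ext ?_) (Fin.ext ?_)
        · rw [h₁]; change u.val - a + a = u.val; omega
        · rw [h₂, hv]

/-- There is a 2D circuit of depth `d` on `w` rows of length `l` that computes the parity of `n`
qubits, with the target qubit in the last row. -/
def LatticeParity (n w l d : ℕ) : Prop :=
  ∃ (A : Matrix (Fin w × Fin l → Bool) (Fin w × Fin l → Bool) ℂ)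
    (ι : Fin n ⊕ Unit ↪ Fin w × Fin l), Realizes IsLineInterval d A ∧
      ComputesParity A (fun i => ι (Sum.inl i)) (ι (Sum.inr ())) ∧
      (ι (Sum.inr ())).1.val + 1 = w

theorem parityOf_equiv {I J : Type} [Fintype I] [Fintype J] (σ : I ≃ J) (x : J → Bool) :
    (parityOf fun i => x (σ i)) = parityOf x := by
  have : (Finset.univ.filter fun j => x j = true) =
      (Finset.univ.filter fun i => x (σ i) = true).map σ.toEmbedding := by
    ext j
    simp
  rw [parityOf, parityOf, this, Finset.card_map]

theorem ComputesParity.equiv {V I J : Type} [Fintype V] [DecidableEq V] [Fintype I] [Fintype J]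
    {A : Matrix (V → Bool) (V → Bool) ℂ} {inp : J → V} {tgt : V}
    (hA : ComputesParity A inp tgt) (σ : I ≃ J) : ComputesParity A (fun i => inp (σ i)) tgt := by
  intro x hx
  rw [parityOf_equiv σ fun j => x (inp j)]
  exact hA x fun v hv => hx v fun i => hv (σ i)

/-- A parity circuit for `m` qubits on a lattice whose input qubits are in the first column. -/
structure ColumnParity (m N d : ℕ) where
  mat : Matrix (Fin N × Fin (N + 1) → Bool) (Fin N × Fin (N + 1) → Bool) ℂ
  row : Fin m ⊕ Unit ↪ Fin N
  realizes : Realizes IsLineInterval d mat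
  computes : ComputesParity mat (fun i => (row (Sum.inl i), 0)) (row (Sum.inr ()), 0)
  row_target : (row (Sum.inr ())).val + 1 = N

theorem ColumnParity.latticeParity {m N d : ℕ} (B : ColumnParity m N d) :
    LatticeParity m N (N + 1) d :=
  ⟨B.mat, ⟨fun i => (B.row i, 0), fun _ _ h => B.row.injective (congrArg Prod.fst h)⟩,
    B.realizes, B.computes, B.row_target⟩

/-- The m blocks stand side by side at the top right and `B` sits at the bottom left. Each block's
result travels down its column to the row of an input of `B`, then left along that row to the first
column. The target of `B` is in the last row of the new lattice, so the construction can be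
iterated. -/
theorem LatticeParity.compose {m N d₀ n w l d : ℕ} (B : ColumnParity m N d₀)
    (hA : LatticeParity n w l d) :
    LatticeParity (m * n) (w + N) (N + 1 + m * l) (2 * (d + 2) + d₀) := by
  obtain ⟨A, ι, hA, hAp, hrow⟩ := hA
  set tgt := ι (Sum.inr ()) with htgt
  set q := B.row (Sum.inr ()) with hq
  have hlast := B.row_target
  obtain ⟨e, he⟩ : ∃ e : Fin m × (Fin w × Fin l) ↪ Fin (w + N) × Fin (N + 1 + m * l),
      ∀ p, e p = (Fin.castAdd N p.2.1, Fin.natAdd (N + 1) (finProdFinEquiv (p.1, p.2.2))) :=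
    ⟨⟨fun p => (Fin.castAdd N p.2.1, Fin.natAdd (N + 1) (finProdFinEquiv (p.1, p.2.2))), by
      rintro ⟨i, r, c⟩ ⟨i', r', c'⟩ h
      simp only [Prod.mk.injEq, Fin.castAdd_inj, Fin.natAdd_inj,
        EmbeddingLike.apply_eq_iff_eq] at h
      simp [h]⟩, fun _ => rfl⟩
  obtain ⟨e₀, he₀⟩ : ∃ e₀ : Fin N × Fin (N + 1) ↪ Fin (w + N) × Fin (N + 1 + m * l),
      ∀ p, e₀ p = (Fin.natAdd w p.1, Fin.castAdd (m * l) p.2) :=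
    ⟨⟨fun p => (Fin.natAdd w p.1, Fin.castAdd (m * l) p.2), by
      rintro ⟨r, c⟩ ⟨r', c'⟩ h
      simp only [Prod.mk.injEq, Fin.castAdd_inj, Fin.natAdd_inj] at h
      simp [h]⟩, fun _ => rfl⟩
  let X : Fin m → Fin (N + 1 + m * l) := fun i =>
    Fin.natAdd (N + 1) (finProdFinEquiv (i, tgt.2))
  let ρ : Fin m → Fin (w + N) := fun i => Fin.natAdd w (B.row (Sum.inl i))
  have hX : ∀ i j, X i = X j → i = j := fun i j h => by
    simp only [X, Fin.natAdd_inj, EmbeddingLike.apply_eq_iff_eq, Prod.mk.injEq] at h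
    exact h.1
  have hρ : ∀ i j, ρ i = ρ j → i = j := fun i j h => by
    simp only [ρ, Fin.natAdd_inj, EmbeddingLike.apply_eq_iff_eq, Sum.inl.injEq] at h
    exact h
  obtain ⟨K, hK, hKp⟩ := exists_composed_parity (P := IsLineInterval) e e₀
    (fun p v h => by
      have h1 := congrArg (fun s => s.1.val) h
      have h2 := p.2.1.isLt
      simp only [he, he₀, Fin.val_castAdd, Fin.val_natAdd] at h1
      omega)
    (fun i S hS => isLineInterval_map _ 0 (N + 1 + l * i) (fun p => by simp [he]) (fun p => by
      simp only [he, Function.Embedding.trans_apply, Function.Embedding.sectR_apply,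
        Fin.val_natAdd, finProdFinEquiv_apply_val]
      ring) S hS)
    (fun S hS => isLineInterval_map e₀ w 0 (fun p => by
      simp only [he₀, Fin.val_natAdd]; ring)
      (fun p => by simp [he₀]) S hS)
    hA (fun j h => by simpa using ι.injective h) hAp B.realizes
    (fun i h => by simpa using B.row.injective (congrArg Prod.fst h)) B.computes
    (fun i => (ρ i, X i))
    (fun i v h => by
      have h1 := congrArg (fun s => s.2.val) h
      have h2 := v.2.isLt
      simp only [X, he₀, Fin.val_castAdd, Fin.val_natAdd] at h1
      omega)
    (fun i p h => by
      have h1 := congrArg (fun s => s.1.val) h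
      have h2 := p.2.1.isLt
      simp only [ρ, he, Fin.val_castAdd, Fin.val_natAdd] at h1
      omega)
    (fun i => Finset.Icc (Fin.castAdd N tgt.1) (ρ i) ×ˢ {X i})
    (fun i => {ρ i} ×ˢ Finset.Icc (Fin.castAdd (m * l) 0) (X i))
    (fun i => isLineInterval_column _ _ _) (fun i => isLineInterval_row _ _ _)
    (fun i j hij => by
      rw [Finset.disjoint_product]
      right
      simpa using fun h => hij (hX i j h))
    (fun i j hij => by
      rw [Finset.disjoint_product]
      left
      simpa using fun h => hij (hρ i j h))
    (fun i => by
      simp only [he, Finset.mem_product, Finset.mem_Icc, Finset.mem_singleton]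
      refine ⟨⟨le_rfl, ?_⟩, rfl⟩
      rw [Fin.le_def]
      have := tgt.1.isLt
      simp only [ρ, Fin.val_castAdd, Fin.val_natAdd]
      omega)
    (fun i => by
      simp only [Finset.mem_product, Finset.mem_Icc, Finset.mem_singleton, and_true, le_refl]
      rw [Fin.le_def]
      have := tgt.1.isLt
      simp only [ρ, Fin.val_castAdd, Fin.val_natAdd]
      omega)
    (fun i => by
      simp only [Finset.mem_product, Finset.mem_Icc, Finset.mem_singleton, and_true, le_refl,
        true_and]
      rw [Fin.le_def]
      simp)
    (fun i => by
      simp only [he₀, Finset.mem_product, Finset.mem_Icc, Finset.mem_singleton]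
      refine ⟨rfl, le_rfl, ?_⟩
      rw [Fin.le_def]
      simp)
    (fun i h => by
      simp only [Finset.mem_product, Finset.mem_singleton] at h
      have h1 := congrArg Fin.val h.2
      simp only [X, he₀, Fin.val_castAdd, Fin.val_natAdd] at h1
      simp at h1
      omega)
    (fun i h => by
      simp only [Finset.mem_product, Finset.mem_singleton] at h
      have h1 := congrArg Fin.val h.1
      simp only [ρ, he₀, Fin.val_natAdd] at h1
      have h2 : B.row (Sum.inr ()) = B.row (Sum.inl i) := Fin.ext (by omega)
      simpa using B.row.injective h2)
    -- A block's target lies in the last row of the block, so the way down from it meets no input.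
    (fun i k j h => by
      simp only [Finset.mem_product, Finset.mem_singleton, Finset.mem_Icc, Fin.le_def] at h
      have h1 := h.1.1
      have h2 := (ι (Sum.inl j)).1.isLt
      simp only [he, Fin.val_castAdd] at h1
      have h3 := h.2
      simp only [he, X, Fin.natAdd_inj,
        EmbeddingLike.apply_eq_iff_eq, Prod.mk.injEq] at h3
      have h4 : ι (Sum.inl j) = tgt := Prod.ext (Fin.ext (by omega)) h3.2
      simpa using ι.injective h4)
    (fun i p h => by
      simp only [Finset.mem_product, Finset.mem_singleton] at h
      have h1 := congrArg Fin.val h.1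
      have h2 := p.2.1.isLt
      simp only [ρ, he, Fin.val_castAdd, Fin.val_natAdd] at h1
      omega)
  refine ⟨K, ⟨Sum.elim (fun i => e ((finProdFinEquiv.symm i).1,
    ι (Sum.inl (finProdFinEquiv.symm i).2))) fun _ => e₀ (q, 0), ?_⟩, hK,
    hKp.equiv finProdFinEquiv.symm, ?_⟩
  · rintro (i | i) (j | j) h
    · have := e.injective h
      simp only [Prod.mk.injEq, EmbeddingLike.apply_eq_iff_eq, Sum.inl.injEq] at this
      rw [finProdFinEquiv.symm.injective (Prod.ext this.1 this.2)]
    · exfalso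
      have h1 := congrArg (fun s => s.1.val) h
      have h2 := (ι (Sum.inl (finProdFinEquiv.symm i).2)).1.isLt
      simp only [Sum.elim_inl, Sum.elim_inr, he, he₀,
        Fin.val_castAdd, Fin.val_natAdd] at h1
      omega
    · exfalso
      have h1 := congrArg (fun s => s.1.val) h
      have h2 := (ι (Sum.inl (finProdFinEquiv.symm j).2)).1.isLt
      simp only [Sum.elim_inl, Sum.elim_inr, he, he₀,
        Fin.val_castAdd, Fin.val_natAdd] at h1
      omega
    · rfl
  · change (e₀ (q, 0)).1.val + 1 = w + N
    rw [he₀]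
    change w + q.val + 1 = w + N
    omega

theorem exists_columnParity {p : ℝ} (hp : 1 / 2 < p) (C : QAC0Family)
    (hC : ∀ n : ℕ, SolvesApproxClean p (C.circuit n) Function.Embedding.inl (parityUnitary n)) :
    ∃ d, ∀ n, Nonempty (ColumnParity n (2 * n + C.ancillas n + 4) d) := by
  obtain ⟨d, hd⟩ := exists_exact_parity hp C hC
  refine ⟨3 * d, fun n => ?_⟩
  obtain ⟨B, hB, hBp⟩ := hd n
  set N := 2 * n + C.ancillas n + 4
  have hcard : Fintype.card (ParityRegister n (C.ancillas n)) = N := by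
    simp only [ParityRegister, Fintype.card_sum, Fintype.card_fin, Fintype.card_unit,
      Fintype.card_bool, N]
    ring
  let σ₀ := Fintype.equivFinOfCardEq hcard
  -- The swap sends the target to the last row, as composition requires.
  let σ := σ₀.trans (Equiv.swap (σ₀ (Sum.inr (Sum.inr ()))) (Fin.last _))
  obtain ⟨W, hW, hWB⟩ := exists_lattice_simulation σ hB
  refine ⟨W, Function.Embedding.inr.trans σ.toEmbedding, hW, hBp.of_placement _ hWB, ?_⟩
  have : σ (Sum.inr (Sum.inr ())) = Fin.last _ := by simp [σ]
  change (σ (Sum.inr (Sum.inr ()))).val + 1 = N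
  rw [this]
  rfl

/-- Another level adds N rows and turns a length l into N + 1 + m·l. The depth is chosen before m
and N, so it stays constant as m grows. -/
theorem exists_latticeParity_pow (d₀ k : ℕ) : ∃ d, ∀ m N, 1 ≤ m → ColumnParity m N d₀ →
    ∃ l, l ≤ (k + 1) * m ^ (k + 1) * (N + 1) ∧
      LatticeParity (m ^ (k + 1)) ((k + 1) * N) l d := by
  induction k with
  | zero =>
    refine ⟨d₀, fun m N hm B => ⟨N + 1, ?_, ?_⟩⟩
    · simpa using Nat.le_mul_of_pos_left (N + 1) hm
    · simpa using B.latticeParity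
  | succ k ih =>
    obtain ⟨d, hd⟩ := ih
    refine ⟨2 * (d + 2) + d₀, fun m N hm B => ?_⟩
    obtain ⟨l, hl, hA⟩ := hd m N hm B
    refine ⟨N + 1 + m * l, ?_, ?_⟩
    · have h1 : 1 ≤ m ^ (k + 1 + 1) := Nat.one_le_pow _ _ hm
      calc N + 1 + m * l ≤ 1 * (N + 1) + m * ((k + 1) * m ^ (k + 1) * (N + 1)) := by
            rw [one_mul]; gcongr
        _ ≤ m ^ (k + 1 + 1) * (N + 1) + m * ((k + 1) * m ^ (k + 1) * (N + 1)) := by gcongr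
        _ = (k + 1 + 1) * m ^ (k + 1 + 1) * (N + 1) := by ring
    · have := LatticeParity.compose B hA
      rwa [← pow_succ', ← Nat.succ_mul] at this

/-! ### Fitting the circuits to a prescribed number of inputs and lattice size -/

theorem ComputesParity.castLE {V : Type} [Fintype V] [DecidableEq V] {n n' : ℕ} (h : n' ≤ n)
    {A : Matrix (V → Bool) (V → Bool) ℂ} {ι : Fin n ⊕ Unit ↪ V}
    (hA : ComputesParity A (fun i => ι (Sum.inl i)) (ι (Sum.inr ()))) :
    ComputesParity A (fun i : Fin n' => ι (Sum.inl (Fin.castLE h i))) (ι (Sum.inr ())) := by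
  intro x hx
  rw [hA x fun v hv => hx v fun i => hv _]
  have : (Finset.univ.filter fun i => x (ι (Sum.inl i)) = true) =
      (Finset.univ.filter fun i => x (ι (Sum.inl (Fin.castLE h i))) = true).map
        (Fin.castLEEmb h) := by
    ext i
    simp only [Finset.mem_filter, Finset.mem_univ, true_and, Finset.mem_map, Fin.coe_castLEEmb]
    constructor
    · intro hi
      by_contra hc
      -- A discarded input has become an ancilla, hence holds 0 and does not affect the parity.
      have := hx (ι (Sum.inl i)) (fun j hj => hc ⟨j, ?_, ?_⟩) (by simp)
      · simp [this] at hi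
      · have hj' : ι (Sum.inl i) = ι (Sum.inl (Fin.castLE h j)) := hj
        rwa [← hj']
      · simpa using hj.symm
    · rintro ⟨j, hj, rfl⟩
      exact hj
  simp only [parityOf, this, Finset.card_map]

theorem ComputesParity.exactlyImplements {V : Type} [Fintype V] [DecidableEq V] {n : ℕ}
    {C : QACCircuit V} {ι : Fin n ⊕ Unit ↪ V}
    (hC : ComputesParity C.toMatrix (fun i => ι (Sum.inl i)) (ι (Sum.inr ()))) :
    ExactlyImplements C ι (parityUnitary n) := by
  have hpl : ∀ φ, withAncilla ι φ = (placement ι fun _ => false).mulVec φ := by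
    intro φ
    ext x
    rw [placement_mulVec_apply]
    rfl
  have hmul : C.toMatrix * placement ι (fun _ => false) =
      placement ι (fun _ => false) * parityUnitary n := by
    refine matrix_ext_ket fun y => ?_
    have hy : (parityUnitary n).mulVec (ket y) = ket (Sum.elim (fun i => y (Sum.inl i))
        fun _ => xor (y (Sum.inr ())) (parityBit fun i => y (Sum.inl i))) := by
      ext z
      rw [mulVec_ket, ket_apply]
      rfl
    have he : ∀ (z : Fin n ⊕ Unit → Bool) v, Function.extend ι z (fun _ => false) (ι v) = z v :=
      fun z v => ι.injective.extend_apply z _ v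
    rw [← Matrix.mulVec_mulVec, ← Matrix.mulVec_mulVec, placement_mulVec_ket, hy,
      placement_mulVec_ket, hC]
    · congr 1
      ext v
      by_cases hv : v ∈ Set.range ι
      · obtain ⟨u, rfl⟩ := hv
        rcases u with i | u
        · rw [Function.update_of_ne (by simp), he, he]
          rfl
        · rw [Function.update_self]
          simp only [he]
          rfl
      · rw [Function.update_of_ne (fun h => hv ⟨_, h.symm⟩), Function.extend_apply' _ _ _ hv,
          Function.extend_apply' _ _ _ hv]
    · intro v hv hvt
      refine Function.extend_apply' _ _ _ ?_
      rintro ⟨i | u, rfl⟩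
      · exact hv i rfl
      · exact hvt rfl
  intro φ _
  rw [hpl, hpl, Matrix.mulVec_mulVec, hmul, ← Matrix.mulVec_mulVec]

theorem LatticeParity.exists_circuit {n w l d n' w' l' : ℕ} (h : LatticeParity n w l d)
    (hn : n' ≤ n) (hw : w ≤ w') (hl : l ≤ l') :
    ∃ (C : QACCircuit (Fin w' × Fin l')) (ι : Fin n' ⊕ Unit ↪ Fin w' × Fin l'),
      C.IsTwoDim ∧ C.depth = d ∧ ExactlyImplements C ι (parityUnitary n') := by
  obtain ⟨A, ι, hA, hAp, -⟩ := h
  let e : Fin w × Fin l ↪ Fin w' × Fin l' := (Fin.castLEEmb hw).prodMap (Fin.castLEEmb hl)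
  have hE : Realizes IsLineInterval d (extendUnitary e A) :=
    hA.extend e (isLineInterval_map e 0 0 (fun _ => rfl) fun _ => rfl)
  obtain ⟨C, hC, hCd, hCm⟩ := hE.exists_circuit
  have hEp := hAp.of_placement e (extendUnitary_mul_placement e A _)
  refine ⟨C, ((Fin.castLEEmb hn).sumMap (Function.Embedding.refl Unit)).trans (ι.trans e), hC,
    hCd, ComputesParity.exactlyImplements ?_⟩
  rw [hCm]
  exact ComputesParity.castLE (ι := ι.trans e) hn hEp

/-! ### Dimensions of the lattice -/

/-- With m = ⌈n^(1/(k+1))⌉, N m is O(n^α) for α = c/(k+1) < ε, and the gap n^(ε-α) eventually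
absorbs all constants. -/
theorem eventually_exists_branching {N : ℕ → ℕ} {K c : ℕ}
    (hN : ∀ m, 1 ≤ m → N m + 1 ≤ K * m ^ c) {ε : ℝ} (hε : 0 < ε) :
    ∃ k : ℕ, ∀ᶠ n : ℕ in Filter.atTop, ∃ m, 1 ≤ m ∧ n ≤ m ^ (k + 1) ∧
      (k + 1) * N m ≤ ⌊(n : ℝ) ^ ε⌋₊ ∧
      (k + 1) * m ^ (k + 1) * (N m + 1) ≤ ⌊(n : ℝ) ^ (1 + ε)⌋₊ := by
  obtain ⟨k, hk⟩ := exists_nat_gt (c / ε)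
  refine ⟨k, ?_⟩
  have hk1 : (0 : ℝ) < k + 1 := by positivity
  set α : ℝ := c / (k + 1) with hα
  have hαε : α < ε := by
    rw [div_lt_iff₀ hε] at hk
    rw [hα, div_lt_iff₀ hk1]
    linarith
  -- One constant for both dimensions; the powers of 2 come from rounding up, m ≤ 2x.
  set Q : ℝ := (k + 1) * 2 ^ (k + 1) * (K * 2 ^ c) with hQ
  have hlim : Filter.Tendsto (fun n : ℕ => (n : ℝ) ^ (ε - α)) Filter.atTop Filter.atTop :=
    (tendsto_rpow_atTop (sub_pos.2 hαε)).comp tendsto_natCast_atTop_atTop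
  filter_upwards [hlim.eventually_ge_atTop Q, Filter.eventually_ge_atTop 1] with n hn hn1
  have hn1' : (1 : ℝ) ≤ n := by exact_mod_cast hn1
  have hn0 : (0 : ℝ) < n := by linarith
  have hQn : Q * (n : ℝ) ^ α ≤ (n : ℝ) ^ ε := by
    calc Q * (n : ℝ) ^ α ≤ (n : ℝ) ^ (ε - α) * (n : ℝ) ^ α := by gcongr
      _ = (n : ℝ) ^ ε := by rw [← Real.rpow_add hn0]; congr 1; ring
  set x : ℝ := (n : ℝ) ^ (1 / ((k : ℝ) + 1)) with hx
  have hx1 : 1 ≤ x := Real.one_le_rpow hn1' (by positivity)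
  have hxk : x ^ (k + 1) = n := by
    rw [hx, ← Real.rpow_natCast, ← Real.rpow_mul hn0.le]
    push_cast
    rw [one_div_mul_cancel hk1.ne', Real.rpow_one]
  have hxc : x ^ c = (n : ℝ) ^ α := by
    rw [hx, ← Real.rpow_natCast, ← Real.rpow_mul hn0.le, hα]
    congr 1
    ring
  set m := ⌈x⌉₊ with hm
  have hmx : x ≤ m := Nat.le_ceil x
  have hmx' : (m : ℝ) ≤ 2 * x := by
    have := Nat.ceil_lt_add_one (zero_le_one.trans hx1)
    linarith
  have hm1 : 1 ≤ m := by
    have : (1 : ℝ) ≤ m := hx1.trans hmx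
    exact_mod_cast this
  have hNm : ((N m : ℝ) + 1) ≤ K * 2 ^ c * (n : ℝ) ^ α := by
    calc ((N m : ℝ) + 1) ≤ K * (m : ℝ) ^ c := by exact_mod_cast hN m hm1
      _ ≤ K * (2 * x) ^ c := by gcongr
      _ = K * 2 ^ c * (n : ℝ) ^ α := by rw [mul_pow, hxc]; ring
  have hmk : (m : ℝ) ^ (k + 1) ≤ 2 ^ (k + 1) * n := by
    calc (m : ℝ) ^ (k + 1) ≤ (2 * x) ^ (k + 1) := by gcongr
      _ = 2 ^ (k + 1) * n := by rw [mul_pow, hxk]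
  refine ⟨m, hm1, ?_, Nat.le_floor ?_, Nat.le_floor ?_⟩
  · have : (n : ℝ) ≤ (m : ℝ) ^ (k + 1) := by rw [← hxk]; gcongr
    exact_mod_cast this
  · push_cast
    have h2 : (1 : ℝ) ≤ 2 ^ (k + 1) := one_le_pow₀ (by norm_num)
    calc ((k : ℝ) + 1) * N m ≤ (k + 1) * 1 * (K * 2 ^ c * (n : ℝ) ^ α) := by
          rw [mul_one]
          gcongr
          linarith
      _ ≤ (k + 1) * 2 ^ (k + 1) * (K * 2 ^ c * (n : ℝ) ^ α) := by gcongr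
      _ = Q * (n : ℝ) ^ α := by rw [hQ]; ring
      _ ≤ _ := hQn
  · push_cast
    calc ((k : ℝ) + 1) * (m : ℝ) ^ (k + 1) * (N m + 1)
        ≤ (k + 1) * (2 ^ (k + 1) * n) * (K * 2 ^ c * (n : ℝ) ^ α) := by gcongr
      _ = n * (Q * (n : ℝ) ^ α) := by rw [hQ]; ring
      _ ≤ n * (n : ℝ) ^ ε := by gcongr
      _ = (n : ℝ) ^ (1 + ε) := by rw [Real.rpow_add hn0, Real.rpow_one]

/-- The finitely many exceptional values are absorbed by the additive constant. -/
theorem exists_poly_bound {s : ℕ → ℕ} {b : ℝ}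
    (h : ∀ᶠ n : ℕ in Filter.atTop, (s n : ℝ) ≤ (n : ℝ) ^ b) :
    ∃ c : ℕ, ∀ n, s n ≤ n ^ c + c := by
  obtain ⟨n₀, hn₀⟩ := Filter.eventually_atTop.1 h
  set c := ⌈b⌉₊ + ∑ n ∈ Finset.range (n₀ + 1), s n with hc
  refine ⟨c, fun n => ?_⟩
  by_cases hn : n < n₀ + 1
  · have := Finset.single_le_sum (f := s) (fun _ _ => Nat.zero_le _) (Finset.mem_range.2 hn)
    omega
  · have hn1 : (1 : ℝ) ≤ n := by
      have : 1 ≤ n := by omega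
      exact_mod_cast this
    have h1 : (s n : ℝ) ≤ (n : ℝ) ^ c := by
      calc (s n : ℝ) ≤ (n : ℝ) ^ b := hn₀ n (by omega)
        _ ≤ (n : ℝ) ^ (c : ℝ) := by
          refine Real.rpow_le_rpow_of_exponent_le hn1 ((Nat.le_ceil b).trans ?_)
          rw [hc]
          exact_mod_cast Nat.le_add_right _ _
        _ = (n : ℝ) ^ c := Real.rpow_natCast _ _
    have h2 : s n ≤ n ^ c := by exact_mod_cast h1
    omega

theorem mainTheorem4 (p : ℝ) (hp : 1 / 2 < p) (C : QAC0Family)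
    (hC : ∀ n : ℕ, SolvesApproxClean p (C.circuit n) Function.Embedding.inl (parityUnitary n))
    (ε : ℝ) (hε : 0 < ε) :
    ∃ D : TwoDimQAC0Family,
      (∀ n : ℕ, ExactlyImplements (D.circuit n) (D.position n) (parityUnitary n)) ∧
      (∀ᶠ n : ℕ in Filter.atTop,
        D.rows n = ⌊(n : ℝ) ^ ε⌋₊ ∧ D.cols n = ⌊(n : ℝ) ^ (1 + ε)⌋₊) := by
  obtain ⟨d₀, hd₀⟩ := exists_columnParity hp C hC
  obtain ⟨c, hc⟩ := C.poly_size
  have hN : ∀ m, 1 ≤ m → (2 * m + C.ancillas m + 4) + 1 ≤ (c + 8) * m ^ (c + 1) := by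
    intro m hm
    have h1 : m ≤ m ^ (c + 1) := Nat.le_self_pow (by omega) m
    have h2 : m ^ c ≤ m ^ (c + 1) := Nat.pow_le_pow_right hm (by omega)
    have h3 := hc m
    have h4 : 1 ≤ m ^ (c + 1) := Nat.one_le_pow _ _ hm
    nlinarith
  obtain ⟨k, hk⟩ := eventually_exists_branching hN hε
  obtain ⟨d, hd⟩ := exists_latticeParity_pow d₀ k
  -- Where no suitable m exists, which happens for finitely many n only, m = n + 1 gives a circuit
  -- of the same depth on a lattice of uncontrolled size.
  have key : ∀ n : ℕ, ∃ (w l : ℕ) (D : QACCircuit (Fin w × Fin l))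
      (ι : Fin n ⊕ Unit ↪ Fin w × Fin l), D.IsTwoDim ∧ D.depth = d ∧
        ExactlyImplements D ι (parityUnitary n) ∧
        ((∃ m, 1 ≤ m ∧ n ≤ m ^ (k + 1) ∧
          (k + 1) * (2 * m + C.ancillas m + 4) ≤ ⌊(n : ℝ) ^ ε⌋₊ ∧
          (k + 1) * m ^ (k + 1) * ((2 * m + C.ancillas m + 4) + 1) ≤ ⌊(n : ℝ) ^ (1 + ε)⌋₊) →
          w = ⌊(n : ℝ) ^ ε⌋₊ ∧ l = ⌊(n : ℝ) ^ (1 + ε)⌋₊) := by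
    intro n
    by_cases h : ∃ m, 1 ≤ m ∧ n ≤ m ^ (k + 1) ∧
          (k + 1) * (2 * m + C.ancillas m + 4) ≤ ⌊(n : ℝ) ^ ε⌋₊ ∧
          (k + 1) * m ^ (k + 1) * ((2 * m + C.ancillas m + 4) + 1) ≤ ⌊(n : ℝ) ^ (1 + ε)⌋₊
    · obtain ⟨m, hm, hnm, hw, hl⟩ := h
      obtain ⟨l, hl', hA⟩ := hd m _ hm (hd₀ m).some
      obtain ⟨D, ι, h1, h2, h3⟩ := hA.exists_circuit hnm hw (hl'.trans hl)
      exact ⟨_, _, D, ι, h1, h2, h3, fun _ => ⟨rfl, rfl⟩⟩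
    · obtain ⟨l, -, hA⟩ := hd (n + 1) _ (by omega) (hd₀ (n + 1)).some
      have hn : n ≤ (n + 1) ^ (k + 1) :=
        (Nat.le_succ n).trans (Nat.le_self_pow (by omega) (n + 1))
      obtain ⟨D, ι, h1, h2, h3⟩ := hA.exists_circuit hn le_rfl le_rfl
      exact ⟨_, _, D, ι, h1, h2, h3, fun h' => absurd h' h⟩
  choose w l D ι hD2 hDd hDe hdim using key
  have hdim' : ∀ᶠ n : ℕ in Filter.atTop, w n = ⌊(n : ℝ) ^ ε⌋₊ ∧ l n = ⌊(n : ℝ) ^ (1 + ε)⌋₊ :=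
    hk.mono hdim
  refine ⟨⟨w, l, D, ι, hD2, ⟨d, fun n => (hDd n).le⟩,
    exists_poly_bound (b := ε + (1 + ε)) ?_⟩, hDe, hdim'⟩
  filter_upwards [hdim', Filter.eventually_ge_atTop 1] with n hn hn1
  have hn0 : (0 : ℝ) < n := by exact_mod_cast hn1
  rw [hn.1, hn.2, Nat.cast_mul, Real.rpow_add hn0 ε]
  exact mul_le_mul (Nat.floor_le (by positivity)) (Nat.floor_le (by positivity)) (by positivity)
    (by positivity)
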